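/- **Notation.** Let $s\in\frac12\mathbb Z_{\ge 0}$, let $q\in\mathbb C^*$ not be a root of unity, $b(x)=x-x^{-1}$, $[X,Y]_q=qXY-q^{-1}YX$. Let $\mathsf b,\mathsf c,\mathsf b^*,\mathsf c^*,\mathsf b^\diamond,\mathsf c^\diamond,r_0,\zeta\in\mathbb C^*$ satisfy $r_0^{-2}=\mathsf b\mathsf c=\mathsf b^*\mathsf c^*=\mathsf b^\diamond\mathsf c^\diamond$, $\zeta^{-2}=\mathsf b^\diamond r_0q^{2s}$, $\zeta^{2}=\mathsf c^\diamond r_0q^{-2s}$. Put $\theta^a_M=\mathsf b^aq^{2M}+\mathsf c^aq^{-2M}$ for $a\in\{\cdot,*,\diamond\}$, where $\theta_M=\theta^{\cdot}_M$, and $$\omega^{\{a,b,c\}}=-(q-q^{-1})^2\Big(\theta^a_s\theta^b_s-\tfrac1{r_0}(q^{2s+1}+q^{-2s-1})\theta^c_s\Big),\quad \rho=-\frac{(q^2-q^{-2})^2}{r_0^2},$$ $$\omega=\omega^{\{\cdot,*,\diamond\}},\quad \eta=\frac{q+q^{-1}}{r_0}\omega^{\{\cdot,\diamond,*\}},\quad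 \eta^*=\frac{q+q^{-1}}{r_0}\omega^{\{*,\diamond,\cdot\}} .$$ **Leonard pair.** Let $(A,A^*)$ be a Leonard pair on a complex vector space $\mathcal V$ of dimension $2s+1$ with eigenvalue sequences $(\theta_M)_{0\le M\le 2s}$ and $(\theta^*_N)_{0\le N\le 2s}$, each without repetitions: there is an eigenbasis $|\theta_M\rangle$ of $A$ in which $A^*$ is irreducible tridiagonal, and an eigenbasis $|\theta^*_N\rangle$ of $A^*$ in which $A$ is irreducible tridiagonal. Assume the Askey–Wilson relations $$[A,[A,A^*]_q]_{q^{-1}}=\rho A^*+\omega A+\eta\,\mathbb I,\qquad [A^*,[A^*,A]_q]_{q^{-1}}=\rho A+\omega A^*+\eta^*\mathbb I .$$ Let $\langle\theta_M|\in\mathcal V^*$ be nonzero covectors with $\langle\theta_M|A=\theta_M\langle\theta_M|$. **Bethe states.** For $m\in\mathbb Z$ and $\alpha,\chi\in\mathbb C^*$ the dynamical operators at $\beta=0$ are $$\mathscr B^{+}(u,m)=\frac{b(u^2)}{\alpha q^{2m+2}}\Big(\frac{\chi q^m}{\rho u}[A^*,A]_q+\frac{\chi q^{m-3}}{\rho\,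 b(q^2)}\big((q^2+1)q^2u^{-1}\omega+q^2\rho(q^2u+u^{-3})\big)\mathbb I\Big),$$ $$\mathscr B^{-}(u,m)=\frac{b(u^2)q^{2m+3}}{\alpha}\Big(\frac{u\chi q^{-m-1}}{\rho}[A^*,A]_q+\frac{\chi q^{-m-4}}{\rho\, b(q^2)}\big(\rho q^2(q^2u^3+u^{-1})+(q^2+1)q^2u\,\omega\big)\mathbb I\Big).$$ For $\epsilon=\pm1$ let $|\Psi^{2s}_\epsilon(\bar u,m)\rangle=\mathscr B^\epsilon(u_1,m+2(2s-1))\cdots\mathscr B^\epsilon(u_{2s},m)|\Omega^\epsilon\rangle$, where $|\Omega^+\rangle=|\theta^*_0\rangle$, $|\Omega^-\rangle=|\theta_0\rangle$ and the gauge parameters satisfy $(q^2-q^{-2})\chi^{-1}\alpha\mathsf c^*q^{m}=1$ for $\epsilon=+$, $(q^2-q^{-2})\chi^{-1}\alpha\mathsf bq^{-m}=-1$ for $\epsilon=-$. Put $$X^{\epsilon,\mathrm{off}}_M(\bar u)=\frac{\langle\theta_M|\Psi^{2s}_\epsilon(\bar u,m)\rangle}{\langle\theta_M|\theta_M\rangle}.$$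 **The linear system.** Define $$\Lambda_1^\epsilon(u)=\tfrac{q^{-2s-1}}{u^\epsilon}\big(q^{2s+1}u\zeta^{-1}-u^{-1}\zeta\big)\big(q^{2s+1}u\zeta-u^{-1}\zeta^{-1}\big)\big(u\mathsf c^*q^{-2s}+u^{-1}\mathsf bq^{2s}\big)\Big(u(\tfrac{\mathsf c}{\mathsf c^*})^{\frac{1-\epsilon}2}+u^{-1}(\tfrac{\mathsf b^*}{\mathsf b})^{\frac{1+\epsilon}2}\Big),$$ $$\Lambda_2^\epsilon(u)=\tfrac{(u^2-u^{-2})q^{-2s-1}}{u^\epsilon(qu^2-q^{-1}u^{-2})}\big(q^{2s-1}u^{-1}\zeta-u\zeta^{-1}\big)\big(q^{2s-1}u^{-1}\zeta^{-1}-u\zeta\big)\big(q^2u\mathsf bq^{2s}+u^{-1}\mathsf c^*q^{-2s}\big)\Big(q^2u(\tfrac{\mathsf b^*}{\mathsf b})^{\frac{1+\epsilon}2}+u^{-1}(\tfrac{\mathsf c}{\mathsf c^*})^{\frac{1-\epsilon}2}\Big),$$ $g(u,\bar u)=\prod_i\big(b(u/u_i)\,b(quu_i)\big)^{-1}$ and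 $$Y_\epsilon(u|\bar u)=\tfrac{u^{2\epsilon+1}\Lambda_1^\epsilon(u)}{b(u^2)b(qu^2)}\prod_i b\big(\tfrac{u}{qu_i}\big)b(uu_i)+\tfrac{q^{-\epsilon-1}u^{-1}\Lambda_2^\epsilon(u)}{b(u^2)b(q^2u^2)}\prod_i b\big(\tfrac{qu}{u_i}\big)b(q^2uu_i)-\delta_{\epsilon,+}q^{-1-4s}\mathsf c^*\prod_{j=0}^{2s}b(q^{\frac12+j-s}u\zeta)\,b(q^{\frac12+j-s}u\zeta^{-1}).$$ (The last product does not depend on the choice of $q^{1/2}$.) For $\bar{\mathcal Y}=(y_1,\dots,y_{2s+1})$ let $\bar{\mathcal Y}_k$ be $\bar{\mathcal Y}$ with $y_k$ removed, and let $\mathcal M^{\epsilon,M}=(\mathcal M^{\epsilon,M}_{jk})_{1\le j,k\le 2s+1}$ with $$\mathcal M^{\epsilon,M}_{jk}=\Big(\frac{y_j}{y_k}\Big)^{\epsilon}\frac{b(y_k^2)}{b(y_j^2)}g(y_k,\bar{\mathcal Y}_k)Y_\epsilon(y_k|\bar{\mathcal Y}_j)+\delta_{jk}\left(\frac{(q+q^{-1})^2}{\rho\,b(y_j^2)b(q^2y_j^2)}\Big(\eta^*+\eta\,\frac{qy_j^2+q^{-1}y_j^{-2}}{q+q^{-1}}\Big)-\theta_M\right).$$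 Call $\bar{\mathcal Y}\in(\mathbb C^*)^{2s+1}$ generic if no denominator vanishes here: $b(y_j^2)$, $b(qy_j^2)$, $b(q^2y_j^2)\ne0$ for all $j$, and $b(y_j/y_k)$, $b(qy_jy_k)\neq0$ for all $j\ne k$. For a matrix $T$, $T_{[k,\ell]}$ denotes $T$ with row $k$ and column $\ell$ deleted. **Proposition.** There are nonzero scalars $\psi^\epsilon_M$ ($\epsilon=\pm1$, $0\le M\le 2s$), independent of $\bar{\mathcal Y}$ and of $m,\alpha,\chi$, and matrices $\mathcal W^{\epsilon,M}=\mathcal W^{\epsilon,M}(\bar{\mathcal Y})$ of size $2s+1$, defined for generic $\bar{\mathcal Y}$ and independent of $m,\alpha,\chi$, such that for all $\epsilon$, $M$ and all generic $\bar{\mathcal Y}$ the matrix $\mathcal W^{\epsilon,M}$ is non-degenerate and, with $\widetilde{\mathcal M}^{\epsilon,M}=\mathcal W^{\epsilon,M}\mathcal M^{\epsilon,M}$: (i) $\widetilde{\mathcal M}^{\epsilon,M}_{2s+1,k}=0$ for all $k=1,\dots,2s+1$; (ii) for each $k$, $\det\widetilde{\mathcal M}^{\epsilon,M}_{[2s+1,k]}$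 is independent of $y_k$ (it takes the same value at any two generic points that differ only in the $k$-th coordinate); (iii) $X^{\epsilon,\mathrm{off}}_M(\bar{\mathcal Y}_k)=\psi^\epsilon_M(-1)^k\det\widetilde{\mathcal M}^{\epsilon,M}_{[2s+1,k]}$ for all $k=1,\dots,2s+1$. -/

import Mathlib

namespace BetheLeonard

/-- `b(x) = x - x⁻¹`. -/
noncomputable def bfun (x : ℂ) : ℂ := x - x⁻¹

/-- The scalar data. Here `d = 2s`, so that `dim V = d + 1` and `s` is an integer or a half-integer;
`p` is a square root of `q`, used only to write the half-integer powers of `q`. The pairs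
`(b, c)`, `(bs, cs)`, `(bd, cd)` parametrise the sequences `θ`, `θ*`, `θ⋄`. -/
structure Params where
  d : ℕ
  p : ℂ
  q : ℂ
  b : ℂ
  c : ℂ
  bs : ℂ
  cs : ℂ
  bd : ℂ
  cd : ℂ
  r0 : ℂ
  ζ : ℂ

namespace Params

/-- The standing assumptions on the scalars. -/
structure Admissible (P : Params) : Prop where
  p_sq : P.p ^ 2 = P.q
  q_ne_zero : P.q ≠ 0
  q_not_root_of_unity : ∀ n : ℕ, 0 < n → P.q ^ n ≠ 1
  b_ne_zero : P.b ≠ 0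
  c_ne_zero : P.c ≠ 0
  bs_ne_zero : P.bs ≠ 0
  cs_ne_zero : P.cs ≠ 0
  bd_ne_zero : P.bd ≠ 0
  cd_ne_zero : P.cd ≠ 0
  r0_ne_zero : P.r0 ≠ 0
  ζ_ne_zero : P.ζ ≠ 0
  r0_eq : P.r0 ^ (-2 : ℤ) = P.b * P.c
  r0_eq_star : P.r0 ^ (-2 : ℤ) = P.bs * P.cs
  r0_eq_diamond : P.r0 ^ (-2 : ℤ) = P.bd * P.cd
  ζ_bd : P.ζ ^ (-2 : ℤ) = P.bd * P.r0 * P.q ^ (P.d : ℤ)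
  ζ_cd : P.ζ ^ (2 : ℤ) = P.cd * P.r0 * P.q ^ (-(P.d : ℤ))

variable (P : Params)

/-- `θ_M = b q^{2M} + c q^{-2M}`. -/
noncomputable def θ (M : ℕ) : ℂ :=
  P.b * P.q ^ (2 * (M : ℤ)) + P.c * P.q ^ (-(2 * (M : ℤ)))

/-- `θ*_N = b* q^{2N} + c* q^{-2N}`. -/
noncomputable def θs (N : ℕ) : ℂ :=
  P.bs * P.q ^ (2 * (N : ℤ)) + P.cs * P.q ^ (-(2 * (N : ℤ)))

/-- `x q^{2s} + y q^{-2s}`, which is `θ^a_s` for `(x, y) = (b^a, c^a)`; the index `s` need not be an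
integer. -/
noncomputable def mid (x y : ℂ) : ℂ := x * P.q ^ (P.d : ℤ) + y * P.q ^ (-(P.d : ℤ))

/-- `θ_s`. -/
noncomputable def θmid : ℂ := P.mid P.b P.c

/-- `θ*_s`. -/
noncomputable def θsmid : ℂ := P.mid P.bs P.cs

/-- `θ⋄_s`. -/
noncomputable def θdmid : ℂ := P.mid P.bd P.cd

/-- `ω^{a,b,c}` as a function of `θ^a_s`, `θ^b_s`, `θ^c_s`. -/
noncomputable def omegaOf (x y z : ℂ) : ℂ :=
  -(P.q - P.q⁻¹) ^ 2 *
    (x * y - 1 / P.r0 * (P.q ^ ((P.d : ℤ) + 1) + P.q ^ (-(P.d : ℤ) - 1)) * z)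

/-- The structure constant `ρ`. -/
noncomputable def ρ : ℂ := -((P.q ^ 2 - P.q ^ (-2 : ℤ)) ^ 2 / P.r0 ^ 2)

/-- The structure constant `ω = ω^{., *, ⋄}`. -/
noncomputable def ω : ℂ := P.omegaOf P.θmid P.θsmid P.θdmid

/-- The structure constant `η = (q + q⁻¹) r₀⁻¹ ω^{., ⋄, *}`. -/
noncomputable def η : ℂ := (P.q + P.q⁻¹) / P.r0 * P.omegaOf P.θmid P.θdmid P.θsmid

/-- The structure constant `η* = (q + q⁻¹) r₀⁻¹ ω^{*, ⋄, .}`. -/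
noncomputable def ηs : ℂ := (P.q + P.q⁻¹) / P.r0 * P.omegaOf P.θsmid P.θdmid P.θmid

end Params

/-- `[X, Y]_q = q X Y - q⁻¹ Y X`. -/
noncomputable def qComm {V : Type*} [AddCommGroup V] [Module ℂ V] (q : ℂ)
    (X Y : Module.End ℂ V) : Module.End ℂ V :=
  q • (X * Y) - q⁻¹ • (Y * X)

/-- The Askey-Wilson relations for `(A, A*)` with structure constants `ρ, ω, η, η*`. -/
structure AskeyWilson (P : Params) {V : Type*} [AddCommGroup V] [Module ℂ V]
    (A As : Module.End ℂ V) : Prop where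
  rel : qComm P.q⁻¹ A (qComm P.q A As) = P.ρ • As + P.ω • A + P.η • (1 : Module.End ℂ V)
  rel_star : qComm P.q⁻¹ As (qComm P.q As A) = P.ρ • A + P.ω • As + P.ηs • (1 : Module.End ℂ V)

/-- `v` is an eigenbasis of `X` with (mutually distinct) eigenvalues `t`, in which the matrix of `Y`
is irreducible tridiagonal. -/
structure IsStandardEigenbasis {n : ℕ} {V : Type*} [AddCommGroup V] [Module ℂ V]
    (X Y : Module.End ℂ V) (t : Fin n → ℂ) (v : Module.Basis (Fin n) ℂ V) : Prop where
  distinct : Function.Injective t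
  eigen : ∀ i, X (v i) = t i • v i
  tridiagonal : ∀ i j : Fin n, (i : ℕ) + 1 < j ∨ (j : ℕ) + 1 < i → v.repr (Y (v j)) i = 0
  irreducible : ∀ i j : Fin n, (i : ℕ) + 1 = j ∨ (j : ℕ) + 1 = i → v.repr (Y (v j)) i ≠ 0

/-- `(A, A*)` is a Leonard pair of `q`-Racah type with eigenvalue sequences `θ_M` and `θ*_N`
(`0 ≤ M, N ≤ 2s`), satisfying the Askey-Wilson relations, and `v`, `w` are eigenbases
`|θ_M⟩` of `A` and `|θ*_N⟩` of `A*` in which the other operator is irreducible tridiagonal. -/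
structure IsLeonardPair (P : Params) {V : Type*} [AddCommGroup V] [Module ℂ V]
    (A As : Module.End ℂ V) (v w : Module.Basis (Fin (P.d + 1)) ℂ V) : Prop where
  askeyWilson : AskeyWilson P A As
  eigenbasis : IsStandardEigenbasis A As (fun M => P.θ M) v
  eigenbasis_star : IsStandardEigenbasis As A (fun N => P.θs N) w

section Bethe

variable (P : Params) {V : Type*} [AddCommGroup V] [Module ℂ V] (A As : Module.End ℂ V)

/-- The dynamical operator `𝓑⁺(u, m)` with parameters `α, β, χ`. The overall prefactor `β` has been
multiplied into the bracket, where it cancels every `1/β`, so that `β = 0` is allowed. -/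
noncomputable def dynBplus (α β χ u : ℂ) (m : ℤ) : Module.End ℂ V :=
  (bfun (u ^ 2) / (α * P.q ^ (2 * m + 2) - β)) •
    ((χ * P.q ^ m / (P.ρ * u)) • qComm P.q As A
      - (β ^ 2 * P.q ^ (-m) / (u * χ)) • qComm P.q A As
      + (β * ((P.q ^ 2 + 1) / (P.q * u))) • A
      - (β * (1 / (P.q * u ^ 3) + P.q * u)) • As
      + (P.q ^ (-m - 3) / (P.ρ * χ * bfun (P.q ^ 2)) *
          ((P.q ^ 2 + 1) * u⁻¹ *
              (P.ω * (χ ^ 2 * P.q ^ (2 * m + 2) - β ^ 2 * P.q ^ 2 * P.ρ)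
                + β * (P.q ^ 4 - 1) * P.ηs * χ * P.q ^ m)
            - P.q ^ 2 * P.ρ * (P.q ^ 2 * u + u ^ (-3 : ℤ)) *
                (β ^ 2 * P.ρ - χ ^ 2 * P.q ^ (2 * m)))) • (1 : Module.End ℂ V))

/-- The dynamical operator `𝓑⁻(u, m)` with parameters `α, β, χ`, the overall prefactor `β` being
again multiplied into the bracket. -/
noncomputable def dynBminus (α β χ u : ℂ) (m : ℤ) : Module.End ℂ V :=
  (bfun (u ^ 2) * P.q ^ (2 * m + 1) / (α * P.q ^ (-2 : ℤ) - β * P.q ^ (2 * m))) •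
    ((u * χ * P.q ^ (-m - 1) / P.ρ) • qComm P.q As A
      - (β ^ 2 * u * P.q ^ (m - 1) / χ) • qComm P.q A As
      + (β * ((P.q ^ 2 * u ^ 4 + 1) / (P.q ^ 2 * u))) • A
      - (β * ((P.q ^ 2 + 1) * u / P.q ^ 2)) • As
      - (P.q ^ (-m - 4) / (P.ρ * χ * bfun (P.q ^ 2)) *
          (P.ρ * P.q ^ 2 * (P.q ^ 2 * u ^ 3 + u⁻¹) * (β ^ 2 * P.ρ * P.q ^ (2 * m) - χ ^ 2)
            + (P.q ^ 2 + 1) * u *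
              (P.ω * (β ^ 2 * P.ρ * P.q ^ (2 * m + 2) - P.q ^ 2 * χ ^ 2)
                + β * (P.q ^ 4 - 1) * P.η * χ * P.q ^ m))) • (1 : Module.End ℂ V))

/-- `𝓑^ε(u, m)`, `ε = ±1`. -/
noncomputable def dynB (ε : ℤˣ) (α β χ u : ℂ) (m : ℤ) : Module.End ℂ V :=
  if ε = 1 then dynBplus P A As α β χ u m else dynBminus P A As α β χ u m

/-- The string `𝓑^ε(u₁, m + 2(n-1)) ⋯ 𝓑^ε(u_n, m)`. -/
noncomputable def stringB (ε : ℤˣ) (α β χ : ℂ) (m : ℤ) {n : ℕ} (u : Fin n → ℂ) :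
    Module.End ℂ V :=
  (List.ofFn fun i : Fin n =>
    dynB P A As ε α β χ (u i) (m + 2 * ((n : ℤ) - 1 - ((i : ℕ) : ℤ)))).prod

/-- The condition linking the gauge parameters `α, χ` to `m`, for `ε = ±1`. -/
def GaugeCondition (ε : ℤˣ) (α χ : ℂ) (m : ℤ) : Prop :=
  if ε = 1 then (P.q ^ 2 - P.q ^ (-2 : ℤ)) * χ⁻¹ * α * P.cs * P.q ^ m = 1
  else (P.q ^ 2 - P.q ^ (-2 : ℤ)) * χ⁻¹ * α * P.b * P.q ^ (-m) = -1

variable (v w : Module.Basis (Fin (P.d + 1)) ℂ V)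

/-- The reference state: `|Ω⁺⟩ = |θ*₀⟩` and `|Ω⁻⟩ = |θ₀⟩`. -/
noncomputable def refState (ε : ℤˣ) : V := if ε = 1 then w 0 else v 0

/-- The Bethe state `|Ψ_ε^n(u, m)⟩` (at `β = 0`); `α, χ` are to satisfy `GaugeCondition`. -/
noncomputable def betheState (ε : ℤˣ) (α χ : ℂ) (m : ℤ) {n : ℕ} (u : Fin n → ℂ) : V :=
  stringB P A As ε α 0 χ m u (refState P v w ε)

/-- The normalized scalar product `X_M^{ε,off}(u) = ⟨θ_M|Ψ_ε^{2s}(u, m)⟩ / ⟨θ_M|θ_M⟩`. -/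
noncomputable def Xoff (bra : Fin (P.d + 1) → Module.Dual ℂ V) (ε : ℤˣ) (α χ : ℂ) (m : ℤ)
    (M : Fin (P.d + 1)) (u : Fin P.d → ℂ) : ℂ :=
  bra M (betheState P A As v w ε α χ m u) / bra M (v M)

end Bethe

section Matrices

variable (P : Params)

/-- `Λ₁^ε(u)`. -/
noncomputable def Λ₁ (ε : ℤˣ) (u : ℂ) : ℂ :=
  P.q ^ (-(P.d : ℤ) - 1) / u ^ (ε : ℤ) *
    (P.q ^ ((P.d : ℤ) + 1) * u * P.ζ⁻¹ - u⁻¹ * P.ζ) *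
    (P.q ^ ((P.d : ℤ) + 1) * u * P.ζ - u⁻¹ * P.ζ⁻¹) *
    (u * P.cs * P.q ^ (-(P.d : ℤ)) + u⁻¹ * P.b * P.q ^ (P.d : ℤ)) *
    (u * (P.c / P.cs) ^ ((1 - (ε : ℤ)) / 2) + u⁻¹ * (P.bs / P.b) ^ ((1 + (ε : ℤ)) / 2))

/-- `Λ₂^ε(u)`. -/
noncomputable def Λ₂ (ε : ℤˣ) (u : ℂ) : ℂ :=
  (u ^ 2 - u ^ (-2 : ℤ)) * P.q ^ (-(P.d : ℤ) - 1) /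
      (u ^ (ε : ℤ) * (P.q * u ^ 2 - P.q⁻¹ * u ^ (-2 : ℤ))) *
    (P.q ^ ((P.d : ℤ) - 1) * u⁻¹ * P.ζ - u * P.ζ⁻¹) *
    (P.q ^ ((P.d : ℤ) - 1) * u⁻¹ * P.ζ⁻¹ - u * P.ζ) *
    (P.q ^ 2 * u * P.b * P.q ^ (P.d : ℤ) + u⁻¹ * P.cs * P.q ^ (-(P.d : ℤ))) *
    (P.q ^ 2 * u * (P.bs / P.b) ^ ((1 + (ε : ℤ)) / 2)
      + u⁻¹ * (P.c / P.cs) ^ ((1 - (ε : ℤ)) / 2))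

/-- `ν₊ = q^{-1-4s} c*`. -/
noncomputable def νplus : ℂ := P.q ^ (-1 - 2 * (P.d : ℤ)) * P.cs

/-- `g(u, ū) = ∏ᵢ (b(u/uᵢ) b(q u uᵢ))⁻¹`. -/
noncomputable def gfun (u : ℂ) {n : ℕ} (us : Fin n → ℂ) : ℂ :=
  ∏ i, (bfun (u / us i) * bfun (P.q * u * us i))⁻¹

/-- `Y_ε(u | ū)`. The power `q^{1/2 + j - s}` is written `p^{1 + 2j - 2s}`. -/
noncomputable def Yfun (ε : ℤˣ) (u : ℂ) {n : ℕ} (us : Fin n → ℂ) : ℂ :=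
  u ^ (2 * (ε : ℤ) + 1) * Λ₁ P ε u / (bfun (u ^ 2) * bfun (P.q * u ^ 2)) *
      ∏ i, (bfun (u / (P.q * us i)) * bfun (u * us i))
    + P.q ^ (-(ε : ℤ) - 1) * u⁻¹ * Λ₂ P ε u / (bfun (u ^ 2) * bfun (P.q ^ 2 * u ^ 2)) *
      ∏ i, (bfun (P.q * u / us i) * bfun (P.q ^ 2 * u * us i))
    - (if ε = 1 then 1 else 0) * νplus P *
      ∏ j ∈ Finset.range (P.d + 1),
        (bfun (P.p ^ (1 + 2 * (j : ℤ) - (P.d : ℤ)) * u * P.ζ) *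
          bfun (P.p ^ (1 + 2 * (j : ℤ) - (P.d : ℤ)) * u * P.ζ⁻¹))

/-- `𝒴̄_k`: the family `y` with its `k`-th member removed. -/
def drop {n : ℕ} (y : Fin (n + 1) → ℂ) (k : Fin (n + 1)) : Fin n → ℂ := fun i => y (k.succAbove i)

/-- The coefficients `L^ε_{jk}`. -/
noncomputable def Lmat (ε : ℤˣ) (y : Fin (P.d + 1) → ℂ) :
    Matrix (Fin (P.d + 1)) (Fin (P.d + 1)) ℂ :=
  Matrix.of fun j k =>
    (y j / y k) ^ (ε : ℤ) * (bfun (y k ^ 2) / bfun (y j ^ 2)) *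
        gfun P (y k) (drop y k) * Yfun P ε (y k) (drop y j)
      + (P.q + P.q⁻¹) ^ 2 / (P.ρ * bfun (y j ^ 2) * bfun (P.q ^ 2 * y j ^ 2)) *
          (P.ηs + P.η * ((P.q * y j ^ 2 + P.q⁻¹ * y j ^ (-2 : ℤ)) / (P.q + P.q⁻¹))) *
          (if j = k then 1 else 0)

/-- The matrix `𝓜^{ε,M} = L^ε - θ_M 𝕀` of the Belliard-Slavnov linear system. -/
noncomputable def BSmat (ε : ℤˣ) (M : Fin (P.d + 1)) (y : Fin (P.d + 1) → ℂ) :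
    Matrix (Fin (P.d + 1)) (Fin (P.d + 1)) ℂ :=
  Lmat P ε y - P.θ M • (1 : Matrix (Fin (P.d + 1)) (Fin (P.d + 1)) ℂ)

/-- The points `y` at which no denominator in the entries of `𝓜^{ε,M}` vanishes. -/
structure Generic (y : Fin (P.d + 1) → ℂ) : Prop where
  ne_zero : ∀ i, y i ≠ 0
  b_sq : ∀ i, bfun (y i ^ 2) ≠ 0
  b_q_sq : ∀ i, bfun (P.q * y i ^ 2) ≠ 0
  b_q2_sq : ∀ i, bfun (P.q ^ 2 * y i ^ 2) ≠ 0
  b_div : ∀ i j, i ≠ j → bfun (y i / y j) ≠ 0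
  b_mul : ∀ i j, i ≠ j → bfun (P.q * y i * y j) ≠ 0

/-- `det T_[2s+1, k]`: the minor of `T` with the last row and the column `k` deleted. -/
noncomputable def lastRowMinor {n : ℕ} (T : Matrix (Fin (n + 1)) (Fin (n + 1)) ℂ)
    (k : Fin (n + 1)) : ℂ :=
  (T.submatrix (Fin.last n).succAbove k.succAbove).det

end Matrices

end BetheLeonard

/-! Everything is transported to polynomials in one operator. Let `Z` be the affine normalisation of
`[A*, A]_q`. At β = 0 the gauge condition turns each 𝓑^ε(u, m + 2j) into a nonzero constant, times a
weight in u, times `Z - z(u²)`, where z(U) = qU + (qU)⁻¹ (`dynB_eq`); m, α and χ drop out. A Bethe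
state is therefore a scalar multiple of `nodePoly(Z)|Ω^ε⟩`, with nodes z(u_i²).

The reference vector is cyclic for `Z` (`IsLeonardPair.cyclic`). The Askey-Wilson relations give a
cubic relation between `Z` and `A` (`AskeyWilson.cubic`). With the values of `A` on |Ω⟩ and Z|Ω⟩, it
fixes the action of `A` on ℂ[Z]|Ω⟩: a q-difference operator f(U) ↦ f₁ f(q⁻²U) + f₂ f(q²U) + f₀ f(U)
(`apply_aeval`, `eval_act`). The two initial values need the first diagonal entry of the other
operator, supplied by `repr_zero_sub`. The coefficients f₁ and f₂ are the factors multiplying the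
products in Y_ε, and f₀ is the diagonal term of 𝓜.

Moreover `gridPoly(Z) = 0` (`aeval_gridPoly`), so polynomials count modulo a polynomial of degree
2s+1. For ε = + the operator raises the degree, and reducing by `gridPoly` produces the last product
in Y_+. Lagrange interpolation at the 2s+1 points z(y_k²) then reads `A Ψ_j = ∑ L_jk Ψ_k`
(`apply_betheVec`), and the vectors Ψ_k form a basis.

Hence the kernel of 𝓜 = L - θ_M is the space of left θ_M-eigenvectors of `A` in this basis: the line
through the numbers ⟨θ_M|Ψ_k⟩ (`kernel_BSmat`). Row operations bring any matrix with one-dimensional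
kernel to a form with zero last row, whose signed minors are the prescribed kernel vector
(`exists_rowOperations`). Independence of y_k is then inherited from Ψ_k, which does not involve
y_k. -/

namespace BetheLeonard
-- Rational identities for the coefficients of the q-difference operator
section
variable {q T b c bs cs r0 H U : ℂ}

/-- The coefficient of the value at `q⁻² U` in the Askey-Wilson operator on `ℂ[Z]|θ₀⟩`. -/
noncomputable def rf1m (q T b c bs cs H U : ℂ) : ℂ :=
  1 / (q * T) * (q ^ 2 * T ^ 2 * U + U⁻¹ - q * T * H) *
    (U * c / T + cs / T + bs * T + b * T / U) / (bfun U * bfun (q * U))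

/-- The coefficient of the value at `q² U` in the Askey-Wilson operator on `ℂ[Z]|θ₀⟩`. -/
noncomputable def rf2m (q T b c bs cs H U : ℂ) : ℂ :=
  1 / (q * T) * (T ^ 2 / q ^ 2 / U + U - T / q * H) *
    (q ^ 4 * b * T * U + q ^ 2 * (bs * T + cs / T) + c / (T * U)) /
      (bfun (q * U) * bfun (q ^ 2 * U))

/-- The coefficient of the value at `q⁻² U` in the Askey-Wilson operator on `ℂ[Z]|θ*₀⟩`. -/
noncomputable def rf1p (q T b c bs cs H U : ℂ) : ℂ :=
  1 / (q * T) * (q ^ 2 * T ^ 2 * U + U⁻¹ - q * T * H) *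
    (U * (U * cs / T + c / T + b * T + bs * T / U)) / (bfun U * bfun (q * U))

/-- The coefficient of the value at `q² U` in the Askey-Wilson operator on `ℂ[Z]|θ*₀⟩`. -/
noncomputable def rf2p (q T b c bs cs H U : ℂ) : ℂ :=
  1 / (q * T) * (T ^ 2 / q ^ 2 / U + U - T / q * H) *
    (q⁻¹ ^ 2 * U⁻¹ * (q ^ 4 * bs * T * U + q ^ 2 * (b * T + c / T) + cs / (T * U))) /
      (bfun (q * U) * bfun (q ^ 2 * U))

/-- The coefficient of the value at `U` in both Askey-Wilson operators. -/
noncomputable def rf0 (q T b c bs cs H U : ℂ) : ℂ :=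
  (((b * T + c / T) * H - (q * T + (q * T)⁻¹) * (bs * T + cs / T)) * (q * U + (q * U)⁻¹) +
    (q + q⁻¹) * ((bs * T + cs / T) * H - (q * T + (q * T)⁻¹) * (b * T + c / T))) /
      (bfun U * bfun (q ^ 2 * U))

lemma bfun_eq {x : ℂ} (hx : x ≠ 0) : bfun x = (x ^ 2 - 1) / x := by
  unfold bfun; field_simp

lemma sq_sub_one_ne {x : ℂ} (hx : x ≠ 0) (h : bfun x ≠ 0) : x ^ 2 - 1 ≠ 0 := by
  rw [bfun_eq hx] at h; intro h0; simp [h0] at h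

/-- First initial condition for the operator on ℂ[Z]|θ₀⟩: its value on 1 must reproduce the
eigenvalue θ₀. -/
lemma rf_sum_minus (hq : q ≠ 0) (hT : T ≠ 0) (hU : U ≠ 0) (h1 : bfun U ≠ 0) (h2 : bfun (q * U) ≠ 0)
    (h3 : bfun (q ^ 2 * U) ≠ 0) :
    rf1m q T b c bs cs H U + rf2m q T b c bs cs H U + rf0 q T b c bs cs H U = b + c := by
  have h1' := sq_sub_one_ne hU h1
  have h2' : q ^ 2 * U ^ 2 - 1 ≠ 0 := by
    rw [← mul_pow]; exact sq_sub_one_ne (mul_ne_zero hq hU) h2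
  have h3' : q ^ 4 * U ^ 2 - 1 ≠ 0 := by
    have := sq_sub_one_ne (mul_ne_zero (pow_ne_zero 2 hq) hU) h3
    rwa [mul_pow, ← pow_mul] at this
  unfold rf1m rf2m rf0
  rw [bfun_eq hU, bfun_eq (mul_ne_zero hq hU), bfun_eq (mul_ne_zero (pow_ne_zero 2 hq) hU)]
  simp only [mul_pow, ← pow_mul, Nat.reduceMul]
  field_simp
  ring

/-- Second initial condition: the value on z = qU + (qU)⁻¹ must match `A_Z_minus`. -/
lemma rf_mul_minus (hq : q ≠ 0) (hT : T ≠ 0) (hU : U ≠ 0) (h1 : bfun U ≠ 0) (h2 : bfun (q * U) ≠ 0)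
    (h3 : bfun (q ^ 2 * U) ≠ 0) :
    rf1m q T b c bs cs H U * (U / q + q / U) + rf2m q T b c bs cs H U * (q ^ 3 * U + (q ^ 3 * U)⁻¹)
      + rf0 q T b c bs cs H U * (q * U + (q * U)⁻¹) =
      (b * q ^ 2 + c / q ^ 2) * (q * U + (q * U)⁻¹) +
      ((q - q⁻¹) * (bs * (1 - T ^ 2) + cs * ((T ^ 2)⁻¹ - 1)) + H * (1 - q ^ 2) * (b * T - c / (T * q ^ 2))) := by
  have h1' := sq_sub_one_ne hU h1
  have h2' : q ^ 2 * U ^ 2 - 1 ≠ 0 := by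
    rw [← mul_pow]; exact sq_sub_one_ne (mul_ne_zero hq hU) h2
  have h3' : q ^ 4 * U ^ 2 - 1 ≠ 0 := by
    have := sq_sub_one_ne (mul_ne_zero (pow_ne_zero 2 hq) hU) h3
    rwa [mul_pow, ← pow_mul] at this
  unfold rf1m rf2m rf0
  rw [bfun_eq hU, bfun_eq (mul_ne_zero hq hU), bfun_eq (mul_ne_zero (pow_ne_zero 2 hq) hU)]
  simp only [mul_pow, ← pow_mul, Nat.reduceMul]
  field_simp
  ring

/-- On ℂ[Z]|θ*₀⟩ the value on 1 already has degree one in z, because |θ*₀⟩ is not an eigenvector of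
A; compare `A_plus`. -/
lemma rf_sum_plus (hq : q ≠ 0) (hT : T ≠ 0) (hU : U ≠ 0) (h1 : bfun U ≠ 0) (h2 : bfun (q * U) ≠ 0)
    (h3 : bfun (q ^ 2 * U) ≠ 0) :
    rf1p q T b c bs cs H U + rf2p q T b c bs cs H U + rf0 q T b c bs cs H U =
      cs / q * (q * U + (q * U)⁻¹) + (c + b * T ^ 2 - cs * H / (q * T)) := by
  have h1' := sq_sub_one_ne hU h1
  have h2' : q ^ 2 * U ^ 2 - 1 ≠ 0 := by
    rw [← mul_pow]; exact sq_sub_one_ne (mul_ne_zero hq hU) h2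
  have h3' : q ^ 4 * U ^ 2 - 1 ≠ 0 := by
    have := sq_sub_one_ne (mul_ne_zero (pow_ne_zero 2 hq) hU) h3
    rwa [mul_pow, ← pow_mul] at this
  unfold rf1p rf2p rf0
  rw [bfun_eq hU, bfun_eq (mul_ne_zero hq hU), bfun_eq (mul_ne_zero (pow_ne_zero 2 hq) hU)]
  simp only [mul_pow, ← pow_mul, Nat.reduceMul]
  field_simp
  ring

lemma rf_mul_plus (hq : q ≠ 0) (hT : T ≠ 0) (hU : U ≠ 0) (h1 : bfun U ≠ 0) (h2 : bfun (q * U) ≠ 0)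
    (h3 : bfun (q ^ 2 * U) ≠ 0) :
    rf1p q T b c bs cs H U * (U / q + q / U) + rf2p q T b c bs cs H U * (q ^ 3 * U + (q ^ 3 * U)⁻¹)
      + rf0 q T b c bs cs H U * (q * U + (q * U)⁻¹) =
      q⁻¹ ^ 2 * (q * U + (q * U)⁻¹) * (cs / q * (q * U + (q * U)⁻¹) + (c + b * T ^ 2 - cs * H / (q * T)))
      + ((q ^ 2 - q⁻¹ ^ 2) * (bs + cs) + (q - q⁻¹) * ((b * T + c / T) * H -
        (q * T + (q * T)⁻¹) * (bs * T + cs / T))) / q := by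
  have h1' := sq_sub_one_ne hU h1
  have h2' : q ^ 2 * U ^ 2 - 1 ≠ 0 := by
    rw [← mul_pow]; exact sq_sub_one_ne (mul_ne_zero hq hU) h2
  have h3' : q ^ 4 * U ^ 2 - 1 ≠ 0 := by
    have := sq_sub_one_ne (mul_ne_zero (pow_ne_zero 2 hq) hU) h3
    rwa [mul_pow, ← pow_mul] at this
  unfold rf1p rf2p rf0
  rw [bfun_eq hU, bfun_eq (mul_ne_zero hq hU), bfun_eq (mul_ne_zero (pow_ne_zero 2 hq) hU)]
  simp only [mul_pow, ← pow_mul, Nat.reduceMul]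
  field_simp
  ring
end
end BetheLeonard

/-! ### Rational identities for the grid and the split sequence -/

namespace BetheLeonard
section
variable {q T b c bs cs r0 H U Q : ℂ}

/-- `z - H` at `z = t U + (t U)⁻¹`. -/
noncomputable def gridF (t H U : ℂ) : ℂ := t * U + (t * U)⁻¹ - H

/-- Isolates the factor that `gridPoly` exchanges for another one when its argument is shifted by
q⁻²; `rf2m_eq` does the same for q². -/
lemma rf1m_eq (hq : q ≠ 0) (hT : T ≠ 0) (hU : U ≠ 0) : rf1m q T b c bs cs H U =
    gridF (q * T) H U * ((U * c / T + cs / T + bs * T + b * T / U) / (bfun U * bfun (q * U))) := by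
  unfold rf1m gridF
  rw [← mul_div_assoc]; congr 2; field_simp

lemma rf2m_eq (hq : q ≠ 0) (hT : T ≠ 0) (hU : U ≠ 0) : rf2m q T b c bs cs H U =
    gridF (q / T) H U * ((q ^ 2)⁻¹ * (q ^ 4 * b * T * U + q ^ 2 * (bs * T + cs / T) + c / (T * U)) /
      (bfun (q * U) * bfun (q ^ 2 * U))) := by
  unfold rf2m gridF
  rw [← mul_div_assoc]; congr 1; rw [← mul_assoc]; congr 1; field_simp; ring

/-- The coefficient sum once both grid factors have been exchanged. As qT = q^{2s+1}, its value is
θ_{2s+1}, one step beyond the spectrum of A. -/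
lemma rf_sum_minus_shift (hq : q ≠ 0) (hT : T ≠ 0) (hU : U ≠ 0) (h1 : bfun U ≠ 0)
    (h2 : bfun (q * U) ≠ 0) (h3 : bfun (q ^ 2 * U) ≠ 0) :
    gridF (1 / (q * T)) H U *
        ((U * c / T + cs / T + bs * T + b * T / U) / (bfun U * bfun (q * U)))
      + gridF (q ^ 3 * T) H U *
        ((q ^ 2)⁻¹ * (q ^ 4 * b * T * U + q ^ 2 * (bs * T + cs / T) + c / (T * U)) /
      (bfun (q * U) * bfun (q ^ 2 * U))) + rf0 q T b c bs cs H U =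
      b * (q * T) ^ 2 + c / (q * T) ^ 2 := by
  have h1' := sq_sub_one_ne hU h1
  have h2' : q ^ 2 * U ^ 2 - 1 ≠ 0 := by
    rw [← mul_pow]; exact sq_sub_one_ne (mul_ne_zero hq hU) h2
  have h3' : q ^ 4 * U ^ 2 - 1 ≠ 0 := by
    have := sq_sub_one_ne (mul_ne_zero (pow_ne_zero 2 hq) hU) h3
    rwa [mul_pow, ← pow_mul] at this
  unfold rf0 gridF
  rw [bfun_eq hU, bfun_eq (mul_ne_zero hq hU), bfun_eq (mul_ne_zero (pow_ne_zero 2 hq) hU)]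
  simp only [mul_pow, ← pow_mul, Nat.reduceMul]
  field_simp
  ring

/-- `ω` in terms of `T = q^{2s}` and `H = ζ² + ζ⁻²`. -/
noncomputable def romega (q T b c bs cs r0 H : ℂ) : ℂ :=
  -(q - q⁻¹) ^ 2 * ((b * T + c / T) * (bs * T + cs / T) - (q * T + (q * T)⁻¹) * H / r0 ^ 2)

/-- `η` in terms of `T = q^{2s}` and `H = ζ² + ζ⁻²`. -/
noncomputable def reta (q T b c bs cs r0 H : ℂ) : ℂ :=
  -(q - q⁻¹) ^ 2 * (q + q⁻¹) / r0 ^ 2 *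
    ((b * T + c / T) * H - (q * T + (q * T)⁻¹) * (bs * T + cs / T))

/-- The first split sequence at `Q = q ^ (2 * i)`. -/
noncomputable def rphi (q T b c bs cs r0 H Q : ℂ) : ℂ :=
  q ^ 2 * (1 - Q) * (1 - Q / (q ^ 2 * T ^ 2)) *
    (c * cs / Q ^ 2 + T * H / (q * r0 ^ 2 * Q) + b * bs * T ^ 2 / q ^ 2)

/-- A partial fraction identity: divided by the two gap factors, the right side becomes a difference
of consecutive values of `φratio`, and the left side the diagonal entry of A* minus θ*_i. -/
lemma rphi_diff (hq : q ≠ 0) (hT : T ≠ 0) (hQ : Q ≠ 0) (hq2 : 1 - q ^ 2 ≠ 0)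
    (hb : b * c = 1 / r0 ^ 2) (hbs0 : bs ≠ 0) (hbs : bs * cs = 1 / r0 ^ 2) :
    -(romega q T b c bs cs r0 H * (b * Q + c / Q) + reta q T b c bs cs r0 H) -
      (bs * Q + cs / Q) * ((q - q⁻¹) ^ 2 * (b * Q - q ^ 2 * c / Q) * (b * Q - c / (q ^ 2 * Q))) =
    (q - q⁻¹) ^ 2 * (rphi q T b c bs cs r0 H (q ^ 2 * Q) * (b * Q - q ^ 2 * c / Q) / (1 - q ^ 2)
      - rphi q T b c bs cs r0 H Q * (b * Q - c / (q ^ 2 * Q)) * q ^ 2 / (1 - q ^ 2)) := by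
  have e : r0 ^ 2 = (b * c)⁻¹ := by rw [hb]; simp
  have e' : cs = b * c / bs := by rw [hb, ← hbs]; field_simp
  unfold romega reta rphi
  rw [e, e']
  field_simp
  ring

/-- Matches the |θ₀⟩-coordinate of (A - θ₁)Z|θ₀⟩ with the constant used in the polynomial model;
`kappa_plus` does this for A|θ*₀⟩. -/
lemma kappa_minus (hq : q ≠ 0) (hT : T ≠ 0) (hq1 : q - q⁻¹ ≠ 0)
    (hb : b * c = 1 / r0 ^ 2) (hbs0 : bs ≠ 0) (hbs : bs * cs = 1 / r0 ^ 2) :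
    (q - q⁻¹) * (b + c) * ((b + c - (b * q ^ 2 + c / q ^ 2)) * (bs + cs)
        + rphi q T b c bs cs r0 H (q ^ 2)) +
      (b + c - (b * q ^ 2 + c / q ^ 2)) * romega q T b c bs cs r0 H / (q - q⁻¹) =
    (q ^ 2 - q⁻¹ ^ 2) / r0 ^ 2 *
      ((q - q⁻¹) * (bs * (1 - T ^ 2) + cs * ((T ^ 2)⁻¹ - 1))
        + H * (1 - q ^ 2) * (b * T - c / (T * q ^ 2))) := by
  have e : r0 ^ 2 = (b * c)⁻¹ := by rw [hb]; simp
  have e' : cs = b * c / bs := by rw [hb, ← hbs]; field_simp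
  have hq3 : q ^ 2 - 1 ≠ 0 := by
    intro h; apply hq1; rw [show q - q⁻¹ = (q ^ 2 - 1) / q by field_simp, h, zero_div]
  unfold romega rphi
  rw [e, e']
  field_simp
  ring

lemma kappa_plus (hq : q ≠ 0) (hT : T ≠ 0) (hq1 : q - q⁻¹ ≠ 0)
    (hb : b * c = 1 / r0 ^ 2) (hbs0 : bs ≠ 0) (hbs : bs * cs = 1 / r0 ^ 2) :
    -romega q T b c bs cs r0 H / (q - q⁻¹) - q * ((bs + cs - (bs * q ^ 2 + cs / q ^ 2)) * (b + c) +
        rphi q T bs cs b c r0 H (q ^ 2)) =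
      bs * q * (q ^ 2 - q⁻¹ ^ 2) * (c + b * T ^ 2 - cs * H / (q * T)) := by
  have e : r0 ^ 2 = (b * c)⁻¹ := by rw [hb]; simp
  have e' : cs = b * c / bs := by rw [hb, ← hbs]; field_simp
  have hq3 : q ^ 2 - 1 ≠ 0 := by
    intro h; apply hq1; rw [show q - q⁻¹ = (q ^ 2 - 1) / q by field_simp, h, zero_div]
  unfold romega rphi
  rw [e, e']
  field_simp
  ring
end
end BetheLeonard

/-! ### Structure constants in terms of T and H, and the two symmetries of the data -/

namespace BetheLeonard
namespace Params
variable (P : Params)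

/-- `q^{2s}`. -/
noncomputable def T : ℂ := P.q ^ (P.d : ℤ)
/-- `ζ² + ζ⁻²`, which is `r₀ θ⋄_s`. -/
noncomputable def H : ℂ := P.ζ ^ 2 + (P.ζ ^ 2)⁻¹

/-- The data with the roles of `A` and `A*` exchanged. -/
def swap : Params := { P with b := P.bs, c := P.cs, bs := P.b, cs := P.c }

/-- The data for the reversed eigenvalue sequence `θ_{2s}, …, θ_0`. -/
noncomputable def flip : Params :=
  { P with b := P.c * P.q ^ (-(2 * (P.d : ℤ))), c := P.b * P.q ^ (2 * (P.d : ℤ)) }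

variable {P}

namespace Admissible
variable (hP : P.Admissible)
include hP

lemma T_ne_zero : P.T ≠ 0 := zpow_ne_zero _ hP.q_ne_zero

lemma bc_eq : P.b * P.c = 1 / P.r0 ^ 2 := by
  rw [← hP.r0_eq, zpow_neg, one_div]; norm_cast

lemma bscs_eq : P.bs * P.cs = 1 / P.r0 ^ 2 := by
  rw [← hP.r0_eq_star, zpow_neg, one_div]; norm_cast

lemma sub_inv_ne_zero : P.q - P.q⁻¹ ≠ 0 := by
  intro h
  have h0 := hP.q_ne_zero
  apply hP.q_not_root_of_unity 2 (by norm_num)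
  field_simp at h
  linear_combination h

lemma add_inv_ne_zero : P.q + P.q⁻¹ ≠ 0 := by
  intro h
  have h0 := hP.q_ne_zero
  apply hP.q_not_root_of_unity 4 (by norm_num)
  field_simp at h
  linear_combination (P.q ^ 2 - 1) * h

lemma sq_sub_inv_sq_ne_zero : P.q ^ 2 - P.q⁻¹ ^ 2 ≠ 0 := by
  rw [show P.q ^ 2 - P.q⁻¹ ^ 2 = (P.q - P.q⁻¹) * (P.q + P.q⁻¹) by ring]
  exact mul_ne_zero hP.sub_inv_ne_zero hP.add_inv_ne_zero

lemma r0_θdmid : P.θdmid = P.H / P.r0 := by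
  have h1 := hP.ζ_bd
  have h2 := hP.ζ_cd
  have hz := hP.ζ_ne_zero
  have hr := hP.r0_ne_zero
  unfold θdmid mid H
  rw [eq_div_iff hr]
  rw [zpow_neg] at h1
  norm_cast at h1 h2
  rw [h1, h2, zpow_natCast]; ring

lemma ω_eq : P.ω = romega P.q P.T P.b P.c P.bs P.cs P.r0 P.H := by
  have hr := hP.r0_ne_zero
  have hq := hP.q_ne_zero
  unfold ω omegaOf romega
  rw [hP.r0_θdmid, show -(P.d : ℤ) - 1 = -((P.d : ℤ) + 1) by ring, zpow_neg, zpow_add_one₀ hq]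
  unfold θmid θsmid mid
  rw [zpow_neg]
  change -(P.q - P.q⁻¹) ^ 2 * ((P.b * P.T + P.c * P.T⁻¹) * (P.bs * P.T + P.cs * P.T⁻¹) -
    1 / P.r0 * (P.T * P.q + (P.T * P.q)⁻¹) * (P.H / P.r0)) = _
  field_simp

lemma η_eq : P.η = reta P.q P.T P.b P.c P.bs P.cs P.r0 P.H := by
  have hr := hP.r0_ne_zero
  have hq := hP.q_ne_zero
  unfold η omegaOf reta
  rw [hP.r0_θdmid, show -(P.d : ℤ) - 1 = -((P.d : ℤ) + 1) by ring, zpow_neg, zpow_add_one₀ hq]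
  unfold θmid θsmid mid
  rw [zpow_neg]
  change (P.q + P.q⁻¹) / P.r0 * (-(P.q - P.q⁻¹) ^ 2 * ((P.b * P.T + P.c * P.T⁻¹) * (P.H / P.r0) -
    1 / P.r0 * (P.T * P.q + (P.T * P.q)⁻¹) * (P.bs * P.T + P.cs * P.T⁻¹))) = _
  field_simp

omit hP in
omit hP in
lemma ω_swap : P.swap.ω = P.ω := by
  unfold ω omegaOf
  change -(P.q - P.q⁻¹) ^ 2 * (P.θsmid * P.θmid - 1 / P.r0 * (P.q ^ ((P.d : ℤ) + 1) +
    P.q ^ (-(P.d : ℤ) - 1)) * P.θdmid) = _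
  ring

lemma swap : P.swap.Admissible where
  p_sq := hP.p_sq
  q_ne_zero := hP.q_ne_zero
  q_not_root_of_unity := hP.q_not_root_of_unity
  b_ne_zero := hP.bs_ne_zero
  c_ne_zero := hP.cs_ne_zero
  bs_ne_zero := hP.b_ne_zero
  cs_ne_zero := hP.c_ne_zero
  bd_ne_zero := hP.bd_ne_zero
  cd_ne_zero := hP.cd_ne_zero
  r0_ne_zero := hP.r0_ne_zero
  ζ_ne_zero := hP.ζ_ne_zero
  r0_eq := hP.r0_eq_star
  r0_eq_star := hP.r0_eq
  r0_eq_diamond := hP.r0_eq_diamond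
  ζ_bd := hP.ζ_bd
  ζ_cd := hP.ζ_cd

lemma ηs_eq : P.ηs = reta P.q P.T P.bs P.cs P.b P.c P.r0 P.H := hP.swap.η_eq

lemma flip : P.flip.Admissible where
  p_sq := hP.p_sq
  q_ne_zero := hP.q_ne_zero
  q_not_root_of_unity := hP.q_not_root_of_unity
  b_ne_zero := mul_ne_zero hP.c_ne_zero (zpow_ne_zero _ hP.q_ne_zero)
  c_ne_zero := mul_ne_zero hP.b_ne_zero (zpow_ne_zero _ hP.q_ne_zero)
  bs_ne_zero := hP.bs_ne_zero
  cs_ne_zero := hP.cs_ne_zero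
  bd_ne_zero := hP.bd_ne_zero
  cd_ne_zero := hP.cd_ne_zero
  r0_ne_zero := hP.r0_ne_zero
  ζ_ne_zero := hP.ζ_ne_zero
  r0_eq := by
    change P.r0 ^ (-2 : ℤ) = P.c * P.q ^ (-(2 * (P.d : ℤ))) * (P.b * P.q ^ (2 * (P.d : ℤ)))
    have := hP.q_ne_zero
    rw [hP.r0_eq, zpow_neg]; field_simp
  r0_eq_star := hP.r0_eq_star
  r0_eq_diamond := hP.r0_eq_diamond
  ζ_bd := hP.ζ_bd
  ζ_cd := hP.ζ_cd

/-- Reversal exchanges the two summands of θ_s, so every structure constant is unchanged. -/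
lemma θmid_flip : P.flip.θmid = P.θmid := by
  have := hP.q_ne_zero
  change P.c * P.q ^ (-(2 * (P.d : ℤ))) * P.q ^ (P.d : ℤ) + P.b * P.q ^ (2 * (P.d : ℤ)) *
    P.q ^ (-(P.d : ℤ)) = P.b * P.q ^ (P.d : ℤ) + P.c * P.q ^ (-(P.d : ℤ))
  rw [mul_assoc, mul_assoc, ← zpow_add₀ this, ← zpow_add₀ this]
  ring_nf

lemma ω_flip : P.flip.ω = P.ω := by
  unfold ω; rw [hP.θmid_flip]; rfl

lemma η_flip : P.flip.η = P.η := by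
  unfold η; rw [hP.θmid_flip]; rfl

lemma ηs_flip : P.flip.ηs = P.ηs := by
  unfold ηs; rw [hP.θmid_flip]; rfl

lemma θ_flip {M N : ℕ} (h : M + N = P.d) : P.flip.θ M = P.θ N := by
  have hq := hP.q_ne_zero
  change P.c * P.q ^ (-(2 * (P.d : ℤ))) * P.q ^ (2 * (M : ℤ)) + P.b * P.q ^ (2 * (P.d : ℤ)) *
    P.q ^ (-(2 * (M : ℤ))) = P.b * P.q ^ (2 * (N : ℤ)) + P.c * P.q ^ (-(2 * (N : ℤ)))
  rw [mul_assoc, mul_assoc, ← zpow_add₀ hq, ← zpow_add₀ hq, add_comm, ← h]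
  push_cast; ring_nf

omit hP in
lemma θ_eq (M : ℕ) : P.θ M = P.b * (P.q ^ 2) ^ M + P.c / (P.q ^ 2) ^ M := by
  unfold θ; rw [zpow_neg, div_eq_mul_inv, ← pow_mul]; norm_cast

omit hP in
lemma θ_zero : P.θ 0 = P.b + P.c := by simp [θ_eq]

omit hP in
lemma θ_one : P.θ 1 = P.b * P.q ^ 2 + P.c / P.q ^ 2 := by simp [θ_eq]

end Admissible
end Params
end BetheLeonard

/-! ### Symmetries of the Leonard pair and the diagonal of A* -/

namespace BetheLeonard
open Params
variable {P : Params} {V : Type*} [AddCommGroup V] [Module ℂ V] {A As : Module.End ℂ V}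
  {v w : Module.Basis (Fin (P.d + 1)) ℂ V}

lemma IsStandardEigenbasis.repr_apply {n : ℕ} {X Y : Module.End ℂ V} {t : Fin n → ℂ}
    {v : Module.Basis (Fin n) ℂ V} (h : IsStandardEigenbasis X Y t v) (x : V) (i : Fin n) :
    v.repr (X x) i = t i * v.repr x i := by
  have : v.coord i ∘ₗ X = t i • v.coord i := by
    refine v.ext fun j => ?_
    by_cases hij : j = i
    · subst hij; simp [h.eigen]
    · simp [h.eigen, hij]
  simpa using LinearMap.congr_fun this x

lemma IsStandardEigenbasis.rev {n : ℕ} {X Y : Module.End ℂ V} {t : Fin n → ℂ}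
    {v : Module.Basis (Fin n) ℂ V} (h : IsStandardEigenbasis X Y t v) :
    IsStandardEigenbasis X Y (fun i => t (Fin.rev i)) (v.reindex Fin.revPerm) where
  distinct := h.distinct.comp Fin.rev_injective
  eigen i := by simpa using h.eigen (Fin.rev i)
  tridiagonal i j hij := by
    have := h.tridiagonal (Fin.rev i) (Fin.rev j) (by simp only [Fin.val_rev]; omega)
    simpa using this
  irreducible i j hij := by
    have := h.irreducible (Fin.rev i) (Fin.rev j) (by simp only [Fin.val_rev]; omega)
    simpa using this

namespace IsLeonardPair

lemma swap (hA : IsLeonardPair P A As v w) : IsLeonardPair P.swap As A w v where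
  askeyWilson :=
    { rel := by rw [Admissible.ω_swap]; exact hA.askeyWilson.rel_star
      rel_star := by rw [Admissible.ω_swap]; exact hA.askeyWilson.rel }
  eigenbasis := hA.eigenbasis_star
  eigenbasis_star := hA.eigenbasis

lemma flip (hP : P.Admissible) (hA : IsLeonardPair P A As v w) :
    IsLeonardPair P.flip A As (v.reindex Fin.revPerm) w where
  askeyWilson :=
    { rel := by rw [hP.ω_flip, hP.η_flip]; exact hA.askeyWilson.rel
      rel_star := by rw [hP.ω_flip, hP.ηs_flip]; exact hA.askeyWilson.rel_star }
  eigenbasis := by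
    have hθ : ∀ M : Fin (P.d + 1), P.flip.θ M = P.θ (Fin.rev M) := fun M =>
      hP.θ_flip (by have := M.2; simp only [Fin.val_rev]; omega)
    have h := hA.eigenbasis.rev
    rw [show (fun i => P.θ (Fin.rev i)) = fun M : Fin (P.d + 1) => P.flip.θ M from
      funext fun M => (hθ M).symm] at h
    exact h
  eigenbasis_star := hA.eigenbasis_star

end IsLeonardPair

/-- The coefficient of the diagonal entry in `diag` factors into multiples of θ_{M-1} - θ_M and θ_M
- θ_{M+1}; the entry is determined unless one of these gaps vanishes. -/
lemma Params.Admissible.ρ_add_sq (hP : P.Admissible) (M : ℕ) :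
    (P.q - P.q⁻¹) ^ 2 * P.θ M ^ 2 + P.ρ =
    (P.q - P.q⁻¹) ^ 2 * (P.b * (P.q ^ 2) ^ M - P.q ^ 2 * P.c / (P.q ^ 2) ^ M) *
      (P.b * (P.q ^ 2) ^ M - P.c / (P.q ^ 2 * (P.q ^ 2) ^ M)) := by
  have hq := hP.q_ne_zero
  have hQ : (P.q ^ 2) ^ M ≠ 0 := by positivity
  rw [Admissible.θ_eq]
  have : P.ρ = -((P.q ^ 2 - P.q⁻¹ ^ 2) ^ 2 * (P.b * P.c)) := by
    rw [hP.bc_eq]; unfold ρ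
    rw [zpow_neg, inv_pow]; norm_cast; ring
  rw [this]
  generalize (P.q ^ 2) ^ M = Q at *
  field_simp
  ring

/-- Since A is diagonal, the diagonal part of A²A* - (q² + q⁻²)AA*A + A*A² is (2 - q² - q⁻²)θ_i²
times that of A*. -/
lemma IsLeonardPair.diag (hA : IsLeonardPair P A As v w) (hP : P.Admissible) (i : Fin (P.d + 1)) :
    v.repr (As (v i)) i * ((P.q - P.q⁻¹) ^ 2 * P.θ i ^ 2 + P.ρ) = -(P.ω * P.θ i + P.η) := by
  have h := congrArg (fun x => v.repr x i) (LinearMap.congr_fun hA.askeyWilson.rel (v i))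
  have hq := hP.q_ne_zero
  simp only [qComm, LinearMap.sub_apply, LinearMap.smul_apply, Module.End.mul_apply, map_sub,
    map_smul, LinearMap.add_apply, map_add, hA.eigenbasis.repr_apply, hA.eigenbasis.eigen,
    Finsupp.add_apply, Finsupp.sub_apply, Finsupp.smul_apply, smul_eq_mul, Module.End.one_apply,
    Module.Basis.repr_self, Finsupp.single_eq_same, inv_inv] at h
  generalize v.repr (As (v i)) i = α at *
  field_simp at h ⊢
  linear_combination (-1 : ℂ) * h

lemma IsLeonardPair.trace (hA : IsLeonardPair P A As v w) :
    ∑ i, v.repr (As (v i)) i = ∑ i : Fin (P.d + 1), P.θs i := by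
  have h1 := LinearMap.trace_eq_matrix_trace ℂ v As
  have h2 := LinearMap.trace_eq_matrix_trace ℂ w As
  rw [h1] at h2
  simpa [Matrix.trace, LinearMap.toMatrix_apply, hA.eigenbasis_star.eigen] using h2
end BetheLeonard

/-! ### The split sequence and the first diagonal entry of A* -/

namespace BetheLeonard
open Params
variable {P : Params} {V : Type*} [AddCommGroup V] [Module ℂ V] {A As : Module.End ℂ V}
  {v w : Module.Basis (Fin (P.d + 1)) ℂ V}

namespace Params
variable (P)

/-- `b q^{2M} - c q^{2-2M}`, proportional to `θ_{M-1} - θ_M`. -/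
noncomputable def gap (M : ℕ) : ℂ := P.b * (P.q ^ 2) ^ M - P.q ^ 2 * P.c / (P.q ^ 2) ^ M

/-- The first split sequence. -/
noncomputable def φ (M : ℕ) : ℂ := rphi P.q P.T P.b P.c P.bs P.cs P.r0 P.H ((P.q ^ 2) ^ M)

/-- The difference of consecutive values is `⟨θ_M|A*|θ_M⟩ - θ*_M`. -/
noncomputable def φratio (M : ℕ) : ℂ := P.φ M * P.q ^ 2 / ((1 - P.q ^ 2) * P.gap M)

variable {P}
namespace Admissible
variable (hP : P.Admissible)
include hP

lemma one_sub_sq_ne_zero : 1 - P.q ^ 2 ≠ 0 :=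
  sub_ne_zero.2 fun h => hP.q_not_root_of_unity 2 (by norm_num) h.symm

lemma gap_succ (M : ℕ) :
    P.gap (M + 1) = P.q ^ 2 * (P.b * (P.q ^ 2) ^ M - P.c / (P.q ^ 2 * (P.q ^ 2) ^ M)) := by
  have hq := hP.q_ne_zero
  have hQ : (P.q ^ 2) ^ M ≠ 0 := by positivity
  unfold gap
  rw [pow_succ]
  generalize (P.q ^ 2) ^ M = Q at *
  field_simp

lemma θ_sub_succ (M : ℕ) : P.θ M - P.θ (M + 1) = (1 - P.q ^ 2) / P.q ^ 2 * P.gap (M + 1) := by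
  have hq := hP.q_ne_zero
  have hQ : (P.q ^ 2) ^ M ≠ 0 := by positivity
  unfold gap
  rw [Admissible.θ_eq, Admissible.θ_eq, pow_succ]
  generalize (P.q ^ 2) ^ M = Q at *
  field_simp
  ring

omit hP in
lemma φ_zero : P.φ 0 = 0 := by simp [φ, rphi]

lemma φ_last : P.φ (P.d + 1) = 0 := by
  have hq := hP.q_ne_zero
  have h : (P.q ^ 2) ^ (P.d + 1) / (P.q ^ 2 * P.T ^ 2) = 1 := by
    rw [T, zpow_natCast, div_eq_one_iff_eq (by positivity)]; ring
  simp [φ, rphi, h]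

/-- Two vanishing gaps would give b = q²c and bQ² = q²c with Q = q^{2(n+1)}, hence Q² = 1. -/
lemma gap_ne_zero_or (n : ℕ) : P.gap 0 ≠ 0 ∨ P.gap (n + 1) ≠ 0 := by
  by_contra! h
  obtain ⟨h0, h1⟩ := h
  have hq := hP.q_ne_zero
  have hc := hP.c_ne_zero
  unfold gap at h0 h1
  have hb : P.b = P.q ^ 2 * P.c := by simpa [sub_eq_zero] using h0
  rw [hb] at h1
  apply hP.q_not_root_of_unity (2 * (2 * (n + 1))) (by omega)
  have hQ : (P.q ^ 2) ^ (n + 1) ≠ 0 := by positivity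
  have h2 : P.q ^ (2 * (2 * (n + 1))) = ((P.q ^ 2) ^ (n + 1)) ^ 2 := by rw [← pow_mul, ← pow_mul]; ring_nf
  rw [h2]
  generalize (P.q ^ 2) ^ (n + 1) = Q at *
  field_simp at h1
  rw [mul_zero] at h1
  have := (mul_eq_zero.1 h1).resolve_left (mul_ne_zero (pow_ne_zero 2 hq) hc)
  linear_combination this

end Admissible
end Params

namespace IsLeonardPair
variable (hA : IsLeonardPair P A As v w) (hP : P.Admissible)
include hA hP

lemma gap_ne_zero {M : ℕ} (hM : M < P.d) : P.gap (M + 1) ≠ 0 := by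
  intro h
  have h1 := hP.θ_sub_succ M
  rw [h, mul_zero, sub_eq_zero] at h1
  have := hA.eigenbasis.distinct
    (show (fun i : Fin (P.d + 1) => P.θ i) ⟨M, by omega⟩ = (fun i : Fin (P.d + 1) => P.θ i) ⟨M + 1, by omega⟩ from h1)
  simp at this

lemma repr_sub_θs (i : Fin (P.d + 1)) (h0 : P.gap i ≠ 0) (h1 : P.gap (i + 1) ≠ 0) :
    v.repr (As (v i)) i - P.θs i = P.φratio (i + 1) - P.φratio i := by
  have hq := hP.q_ne_zero
  have hQ : (P.q ^ 2) ^ (i : ℕ) ≠ 0 := by positivity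
  have hd := hA.diag hP i
  have hr := rphi_diff (H := P.H) hq hP.T_ne_zero hQ hP.one_sub_sq_ne_zero hP.bc_eq hP.bs_ne_zero hP.bscs_eq
  rw [hP.ρ_add_sq, Admissible.θ_eq, hP.ω_eq, hP.η_eq] at hd
  rw [← hd] at hr
  have h1' := hP.gap_succ i
  have hθs : P.θs i = P.bs * (P.q ^ 2) ^ (i : ℕ) + P.cs / (P.q ^ 2) ^ (i : ℕ) :=
    Admissible.θ_eq (P := P.swap) i
  have hq1 := hP.sub_inv_ne_zero
  have hq2 := hP.one_sub_sq_ne_zero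
  unfold φratio
  rw [hθs, h1']
  rw [h1'] at h1
  replace h1 := right_ne_zero_of_mul h1
  unfold φ
  unfold gap at h0 ⊢
  rw [show (P.q ^ 2) ^ ((i : ℕ) + 1) = P.q ^ 2 * (P.q ^ 2) ^ (i : ℕ) by ring]
  generalize v.repr (As (v i)) i = α at *
  generalize (P.q ^ 2) ^ (i : ℕ) = Q at *
  generalize P.b * Q - P.q ^ 2 * P.c / Q = X at *
  generalize P.b * Q - P.c / (P.q ^ 2 * Q) = Y at *
  generalize rphi P.q P.T P.b P.c P.bs P.cs P.r0 P.H (P.q ^ 2 * Q) = φ₁ at *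
  generalize rphi P.q P.T P.b P.c P.bs P.cs P.r0 P.H Q = φ₀ at *
  generalize P.bs * Q + P.cs / Q = t at *
  have hr2 : (α - t) * (X * Y) = φ₁ * X / (1 - P.q ^ 2) - φ₀ * Y * P.q ^ 2 / (1 - P.q ^ 2) := by
    apply mul_left_cancel₀ (pow_ne_zero 2 hq1)
    rw [← hr]; ring
  have : α - t = (φ₁ * X / (1 - P.q ^ 2) - φ₀ * Y * P.q ^ 2 / (1 - P.q ^ 2)) / (X * Y) := by
    rw [← hr2]; field_simp
  rw [this]
  field_simp

/-- Normally this is the telescoping formula at i = 0, where `φ` vanishes. If `gap 0 = 0`, the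
diagonal equation at i = 0 carries no information; the trace of A* then gives the entry from all the
others, whose sum telescopes because `φ` vanishes at 2s+1 too. -/
lemma repr_zero_sub : (P.θ 0 - P.θ 1) * (v.repr (As (v 0)) 0 - P.θs 0) = P.φ 1 := by
  have htr : ∑ i : Fin (P.d + 1), (v.repr (As (v i)) i - P.θs i) = 0 := by
    rw [Finset.sum_sub_distrib, hA.trace, sub_self]
  -- In dimension one `gap 1` may vanish, but the trace alone determines the entry and `φ 1` is the
  -- final zero of `φ`.
  rcases Nat.eq_zero_or_pos P.d with hd | hd
  · have h0 : ∀ i : Fin (P.d + 1), i = 0 := fun i => by ext; have := i.2; simp; omega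
    have h1 : P.φ 1 = 0 := by simpa [hd] using hP.φ_last
    have : (Finset.univ : Finset (Fin (P.d + 1))) = {0} := by ext i; simp [h0 i]
    rw [this, Finset.sum_singleton] at htr
    rw [h1]; simpa using Or.inr htr
  have hg1 := hA.gap_ne_zero hP hd
  have hq := hP.q_ne_zero
  have hq2 := hP.one_sub_sq_ne_zero
  suffices h : v.repr (As (v 0)) 0 - P.θs 0 = P.φratio 1 by
    rw [h, hP.θ_sub_succ]; unfold φratio
    rw [zero_add] at *
    field_simp
  by_cases hg0 : P.gap 0 = 0
  · have hgd := (hP.gap_ne_zero_or P.d).resolve_left (not_not.2 hg0)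
    rw [Fin.sum_univ_succ] at htr
    have hsum : ∑ i : Fin P.d, (v.repr (As (v i.succ)) i.succ - P.θs i.succ) = - P.φratio 1 := by
      have : ∀ i : Fin P.d, v.repr (As (v i.succ)) i.succ - P.θs i.succ =
          P.φratio (i + 1 + 1) - P.φratio (i + 1) := by
        intro i
        have := hA.repr_sub_θs hP i.succ (hA.gap_ne_zero hP i.2) (by
          rcases Nat.lt_or_ge ((i : ℕ) + 1) P.d with h | h
          · exact hA.gap_ne_zero hP h
          · have : (i : ℕ) + 1 = P.d := by have := i.2; omega
            simpa [this] using hgd)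
        simpa using this
      rw [Finset.sum_congr rfl fun i _ => this i,
        Fin.sum_univ_eq_sum_range (fun i => P.φratio (i + 1 + 1) - P.φratio (i + 1)),
        Finset.sum_range_sub (fun i => P.φratio (i + 1))]
      simp [φratio, hP.φ_last]
    rw [hsum] at htr
    simpa [add_neg_eq_zero] using htr
  · simpa [φratio, Admissible.φ_zero] using hA.repr_sub_θs hP 0 hg0 hg1

end IsLeonardPair
end BetheLeonard

/-! ### The operator Z: cubic relation, cyclic vectors, initial values -/

namespace BetheLeonard
open Params
variable {P : Params} {V : Type*} [AddCommGroup V] [Module ℂ V] {A As : Module.End ℂ V}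
  {v w : Module.Basis (Fin (P.d + 1)) ℂ V}

namespace Params
variable (P)
/-- `q^{2s+1} + q^{-2s-1}`. -/
noncomputable def N : ℂ := P.q * P.T + (P.q * P.T)⁻¹

/-- The coefficient of `Z` in the quadratic relation between `Z` and `A`. -/
noncomputable def e₁ : ℂ :=
  -(P.q - P.q⁻¹) ^ 2 * ((P.b * P.T + P.c / P.T) * P.H - P.N * (P.bs * P.T + P.cs / P.T))

/-- The constant term in the quadratic relation between `Z` and `A`. -/
noncomputable def e₀ : ℂ :=
  -(P.q - P.q⁻¹) ^ 2 * (P.q + P.q⁻¹) *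
    ((P.bs * P.T + P.cs / P.T) * P.H - P.N * (P.b * P.T + P.c / P.T))

/-- The affine normalisation of `[A*, A]_q` with eigenvalues `q^{2j-2s} ζ² + q^{2s-2j} ζ⁻²`. -/
noncomputable def Z (A As : Module.End ℂ V) : Module.End ℂ V :=
  (P.r0 ^ 2 / (P.q ^ 2 - P.q⁻¹ ^ 2)) •
    (qComm P.q As A + (P.ω / (P.q - P.q⁻¹)) • (1 : Module.End ℂ V))

variable {P}
namespace Admissible
variable (hP : P.Admissible)
include hP

lemma η_e₁ : P.r0 ^ 2 * P.η = (P.q + P.q⁻¹) * P.e₁ := by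
  have := hP.r0_ne_zero
  rw [hP.η_eq]; unfold reta e₁ N; field_simp

lemma ηs_e₀ : P.r0 ^ 2 * P.ηs = P.e₀ := by
  have := hP.r0_ne_zero
  rw [hP.ηs_eq]; unfold reta e₀ N; field_simp

lemma ρ_eq : P.r0 ^ 2 * P.ρ = -(P.q ^ 2 - P.q⁻¹ ^ 2) ^ 2 := by
  have := hP.r0_ne_zero
  unfold ρ; rw [zpow_neg, inv_pow]; norm_cast; field_simp

end Admissible
end Params

lemma AskeyWilson.qComm_A (hq : P.q ≠ 0) (h : AskeyWilson P A As) :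
    qComm P.q A (qComm P.q As A) = -(P.ρ • As + P.ω • A + P.η • (1 : Module.End ℂ V)) := by
  rw [← h.rel]
  simp only [qComm, mul_sub, sub_mul, smul_mul_assoc, mul_smul_comm, smul_sub, smul_smul, mul_assoc,
    inv_inv]
  match_scalars <;> field_simp
  ring

lemma AskeyWilson.qComm_As (hq : P.q ≠ 0) (h : AskeyWilson P A As) :
    qComm P.q (qComm P.q As A) As = -(P.ρ • A + P.ω • As + P.ηs • (1 : Module.End ℂ V)) := by
  rw [← h.rel_star]
  simp only [qComm, mul_sub, sub_mul, smul_mul_assoc, mul_smul_comm, smul_sub, smul_smul, mul_assoc,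
    inv_inv]
  match_scalars <;> field_simp
  ring

/-- Elimination of A*: q⁻¹[A, K]_q K - q K[A, K]_q has the left side as its value, and the terms in
A* on the other side combine to ρ[K, A*]_q, which the second Askey-Wilson relation evaluates. -/
lemma AskeyWilson.cubic_aux (hq : P.q ≠ 0) (h : AskeyWilson P A As) {K : Module.End ℂ V}
    (hK : K = qComm P.q As A) :
    K * (K * A) - (P.q ^ 2 + P.q⁻¹ ^ 2) • (K * (A * K)) + A * (K * K) =
      (P.ω * (P.q - P.q⁻¹)) • (K * A + A * K) + (P.η * (P.q - P.q⁻¹)) • K +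
      (P.ω ^ 2 - P.ρ ^ 2) • A + (P.ω * P.η - P.ρ * P.ηs) • (1 : Module.End ℂ V) := by
  have h1 := h.qComm_A hq
  have h2 := h.qComm_As hq
  rw [← hK] at h1 h2
  have h3 := congrArg (fun x => K * x) h1
  have h4 := congrArg (fun x => x * K) h1
  simp only [qComm, mul_sub, sub_mul, smul_mul_assoc, mul_smul_comm, mul_assoc, mul_neg, neg_mul,
    mul_add, add_mul, mul_one, one_mul] at h1 h2 h3 h4
  have e : P.q * P.q⁻¹ = 1 := mul_inv_cancel₀ hq
  linear_combination (norm := skip) P.ρ • h2 - P.q • h3 + P.q⁻¹ • h4 - P.ω • h1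
  match_scalars <;> field_simp <;> ring

/-- The shift by ω/(q - q⁻¹) in `Z` is the one that removes the term KA + AK. -/
lemma AskeyWilson.cubic (hP : P.Admissible) (h : AskeyWilson P A As) :
    P.Z A As * (P.Z A As * A) - (P.q ^ 2 + P.q⁻¹ ^ 2) • (P.Z A As * (A * P.Z A As)) +
        A * (P.Z A As * P.Z A As) =
      (-(P.q ^ 2 - P.q⁻¹ ^ 2) ^ 2) • A + P.e₁ • P.Z A As + P.e₀ • (1 : Module.End ℂ V) := by
  have hq := hP.q_ne_zero
  have hc := h.cubic_aux hq rfl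
  have h1 := hP.sub_inv_ne_zero
  have h2 := hP.add_inv_ne_zero
  have h3 := hP.sq_sub_inv_sq_ne_zero
  have hr := hP.r0_ne_zero
  have he1 : P.e₁ = P.r0 ^ 2 * P.η / (P.q + P.q⁻¹) := by rw [hP.η_e₁, mul_div_cancel_left₀ _ h2]
  have hρ : P.ρ = -(P.q ^ 2 - P.q⁻¹ ^ 2) ^ 2 / P.r0 ^ 2 := by rw [← hP.ρ_eq]; field_simp
  have hf : P.q ^ 2 - P.q⁻¹ ^ 2 = (P.q - P.q⁻¹) * (P.q + P.q⁻¹) := by ring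
  rw [he1, ← hP.ηs_e₀]
  unfold Z
  generalize qComm P.q As A = K at *
  rw [hρ] at hc
  have e : P.q * P.q⁻¹ = 1 := mul_inv_cancel₀ hq
  have e2 : P.q ^ 2 + P.q⁻¹ ^ 2 = 2 + (P.q - P.q⁻¹) ^ 2 := by linear_combination 2 * e
  rw [e2, hf] at hc ⊢
  generalize P.q - P.q⁻¹ = m at *
  generalize P.q + P.q⁻¹ = n at *
  simp only [smul_mul_assoc, mul_smul_comm, add_mul, mul_add, one_mul, mul_one, smul_add, smul_smul,
    mul_assoc]
  linear_combination (norm := skip) (P.r0 ^ 2 / (m * n)) ^ 2 • hc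
  match_scalars <;> field_simp <;> ring

lemma Z_repr (i j : Fin (P.d + 1)) (hA : IsLeonardPair P A As v w) :
    v.repr (P.Z A As (v i)) j = P.r0 ^ 2 / (P.q ^ 2 - P.q⁻¹ ^ 2) *
      ((P.q * P.θ i - P.q⁻¹ * P.θ j) * v.repr (As (v i)) j
        + P.ω / (P.q - P.q⁻¹) * (if i = j then 1 else 0)) := by
  simp only [Z, qComm, LinearMap.sub_apply, LinearMap.smul_apply, Module.End.mul_apply, map_sub,
    map_smul, LinearMap.add_apply, map_add, hA.eigenbasis.repr_apply, hA.eigenbasis.eigen,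
    Finsupp.add_apply, Finsupp.sub_apply, Finsupp.smul_apply, smul_eq_mul, Module.End.one_apply,
    Module.Basis.repr_self, Finsupp.single_apply]
  ring

lemma Z_repr_star (i j : Fin (P.d + 1)) (hA : IsLeonardPair P A As v w) :
    w.repr (P.Z A As (w i)) j = P.r0 ^ 2 / (P.q ^ 2 - P.q⁻¹ ^ 2) *
      ((P.q * P.θs j - P.q⁻¹ * P.θs i) * w.repr (A (w i)) j
        + P.ω / (P.q - P.q⁻¹) * (if i = j then 1 else 0)) := by
  simp only [Z, qComm, LinearMap.sub_apply, LinearMap.smul_apply, Module.End.mul_apply, map_sub,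
    map_smul, LinearMap.add_apply, map_add, hA.eigenbasis_star.repr_apply, hA.eigenbasis_star.eigen,
    Finsupp.add_apply, Finsupp.sub_apply, Finsupp.smul_apply, smul_eq_mul, Module.End.one_apply,
    Module.Basis.repr_self, Finsupp.single_apply]
  ring

open Polynomial in
/-- The first vector of a basis in which `Z` is upper Hessenberg with non-zero subdiagonal is
cyclic for `Z`. -/
lemma exists_aeval_eq {n : ℕ} {Z : Module.End ℂ V} {v : Module.Basis (Fin (n + 1)) ℂ V}
    (h0 : ∀ i j : Fin (n + 1), (i : ℕ) + 1 < j → v.repr (Z (v i)) j = 0)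
    (h1 : ∀ i j : Fin (n + 1), (i : ℕ) + 1 = j → v.repr (Z (v i)) j ≠ 0) (x : V) :
    ∃ p : ℂ[X], aeval Z p (v 0) = x := by
  let S : Submodule ℂ V := LinearMap.range
    ((LinearMap.applyₗ (v 0) : Module.End ℂ V →ₗ[ℂ] V) ∘ₗ (aeval Z : ℂ[X] →ₐ[ℂ] _).toLinearMap)
  have hZ : ∀ y ∈ S, Z y ∈ S := by
    rintro _ ⟨p, rfl⟩
    exact ⟨X * p, by simp⟩
  have hv : ∀ m : ℕ, ∀ hm : m < n + 1, v ⟨m, hm⟩ ∈ S := by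
    intro m
    induction m using Nat.strong_induction_on with
    | _ m ih =>
      intro hm
      rcases m with _ | m
      · exact ⟨1, by simp⟩
      · have hz := hZ _ (ih m (by omega) (by omega))
        rw [← v.sum_repr (Z (v ⟨m, by omega⟩)),
          ← Finset.add_sum_erase _ _ (Finset.mem_univ (⟨m + 1, hm⟩ : Fin (n + 1)))] at hz
        have hr : ∑ j ∈ Finset.univ.erase (⟨m + 1, hm⟩ : Fin (n + 1)),
            v.repr (Z (v ⟨m, by omega⟩)) j • v j ∈ S := by
          refine S.sum_mem fun j hj => ?_
          have hj' : (j : ℕ) ≠ m + 1 := fun h => (Finset.mem_erase.1 hj).1 (Fin.ext h)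
          rcases Nat.lt_or_ge j (m + 1) with h | h
          · exact S.smul_mem _ (ih j h j.2)
          · rw [h0 _ _ (show m + 1 < (j : ℕ) by omega), zero_smul]; exact S.zero_mem
        have := (S.add_mem_iff_left hr).1 hz
        exact (S.smul_mem_iff (h1 _ _ rfl)).1 this
  have : x ∈ S := by
    rw [← v.sum_repr x]
    exact S.sum_mem fun j _ => S.smul_mem _ (hv j j.2)
  obtain ⟨p, hp⟩ := this
  exact ⟨p, hp⟩

namespace IsLeonardPair
variable (hA : IsLeonardPair P A As v w) (hP : P.Admissible)
include hA hP

/-- The subdiagonal of Z is that of A* times a multiple of qθ_i - q⁻¹θ_{i+1}, in which the b-terms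
cancel and a nonzero c-term remains. -/
lemma cyclic_minus (x : V) : ∃ p : Polynomial ℂ, Polynomial.aeval (P.Z A As) p (v 0) = x := by
  have hq := hP.q_ne_zero
  have hc := hP.c_ne_zero
  have hq3 := hP.sq_sub_inv_sq_ne_zero
  have hr := hP.r0_ne_zero
  refine exists_aeval_eq (fun i j hij => ?_) (fun i j hij => ?_) x
  · rw [Z_repr i j hA, hA.eigenbasis.tridiagonal j i (Or.inr hij), if_neg (by rintro rfl; omega)]
    simp
  · rw [Z_repr i j hA, if_neg (by rintro rfl; omega), mul_zero, add_zero]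
    refine mul_ne_zero (div_ne_zero (pow_ne_zero 2 hr) hq3)
      (mul_ne_zero ?_ (hA.eigenbasis.irreducible j i (Or.inr hij)))
    rw [← hij, Admissible.θ_eq, Admissible.θ_eq, pow_succ (P.q ^ 2)]
    have hQ : (P.q ^ 2) ^ (i : ℕ) ≠ 0 := by positivity
    generalize (P.q ^ 2) ^ (i : ℕ) = Q at *
    rw [show P.q * (P.b * Q + P.c / Q) - P.q⁻¹ * (P.b * (Q * P.q ^ 2) + P.c / (Q * P.q ^ 2)) =
      P.c / (Q * P.q) * (P.q ^ 2 - P.q⁻¹ ^ 2) by field_simp; ring]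
    positivity

lemma cyclic_plus (x : V) : ∃ p : Polynomial ℂ, Polynomial.aeval (P.Z A As) p (w 0) = x := by
  have hq := hP.q_ne_zero
  have hb := hP.bs_ne_zero
  have hq3 := hP.sq_sub_inv_sq_ne_zero
  have hr := hP.r0_ne_zero
  refine exists_aeval_eq (fun i j hij => ?_) (fun i j hij => ?_) x
  · rw [Z_repr_star i j hA, hA.eigenbasis_star.tridiagonal j i (Or.inr hij),
      if_neg (by rintro rfl; omega)]
    simp
  · rw [Z_repr_star i j hA, if_neg (by rintro rfl; omega), mul_zero, add_zero]
    refine mul_ne_zero (div_ne_zero (pow_ne_zero 2 hr) hq3)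
      (mul_ne_zero ?_ (hA.eigenbasis_star.irreducible j i (Or.inr hij)))
    have hθ : ∀ M, P.θs M = P.bs * (P.q ^ 2) ^ M + P.cs / (P.q ^ 2) ^ M :=
      fun M => Admissible.θ_eq (P := P.swap) M
    rw [← hij, hθ, hθ, pow_succ (P.q ^ 2)]
    have hQ : (P.q ^ 2) ^ (i : ℕ) ≠ 0 := by positivity
    generalize (P.q ^ 2) ^ (i : ℕ) = Q at *
    rw [show P.q * (P.bs * (Q * P.q ^ 2) + P.cs / (Q * P.q ^ 2)) - P.q⁻¹ * (P.bs * Q + P.cs / Q) =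
      P.bs * Q * P.q * (P.q ^ 2 - P.q⁻¹ ^ 2) by field_simp; ring]
    positivity

/-- Z|θ₀⟩ lies in the span of |θ₀⟩ and |θ₁⟩, so A - θ₁ maps it to a multiple of |θ₀⟩;
`repr_zero_sub` gives the multiple. -/
lemma A_Z_minus : A (P.Z A As (v 0)) = P.θ 1 • P.Z A As (v 0) +
    ((P.q - P.q⁻¹) * (P.bs * (1 - P.T ^ 2) + P.cs * ((P.T ^ 2)⁻¹ - 1))
        + P.H * (1 - P.q ^ 2) * (P.b * P.T - P.c / (P.T * P.q ^ 2))) • v 0 := by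
  have hq := hP.q_ne_zero
  have hr := hP.r0_ne_zero
  have hq3 := hP.sq_sub_inv_sq_ne_zero
  have hk := kappa_minus (H := P.H) hq hP.T_ne_zero hP.sub_inv_ne_zero hP.bc_eq hP.bs_ne_zero hP.bscs_eq
  have h0 := hA.repr_zero_sub hP
  have hθs : P.θs 0 = P.bs + P.cs := Admissible.θ_zero (P := P.swap)
  have hφ : P.φ 1 = rphi P.q P.T P.b P.c P.bs P.cs P.r0 P.H (P.q ^ 2) := by rw [φ, pow_one]
  rw [← hP.ω_eq, ← hθs, ← hφ, ← h0, ← Admissible.θ_zero, ← Admissible.θ_one] at hk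
  apply v.repr.injective
  ext i
  simp only [map_add, map_smul, Finsupp.add_apply, Finsupp.smul_apply, smul_eq_mul,
    hA.eigenbasis.repr_apply, Z_repr _ _ hA, Module.Basis.repr_self]
  rcases Nat.lt_trichotomy i 1 with hi | hi | hi
  · obtain rfl : i = 0 := Fin.ext (by rw [Fin.val_zero]; omega)
    rw [if_pos rfl, Finsupp.single_eq_same, mul_one, mul_one, Fin.val_zero]
    have : (P.q - P.q⁻¹) * (P.bs * (1 - P.T ^ 2) + P.cs * ((P.T ^ 2)⁻¹ - 1))
        + P.H * (1 - P.q ^ 2) * (P.b * P.T - P.c / (P.T * P.q ^ 2)) =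
        P.r0 ^ 2 / (P.q ^ 2 - P.q⁻¹ ^ 2) * ((P.q ^ 2 - P.q⁻¹ ^ 2) / P.r0 ^ 2 *
        ((P.q - P.q⁻¹) * (P.bs * (1 - P.T ^ 2) + P.cs * ((P.T ^ 2)⁻¹ - 1))
        + P.H * (1 - P.q ^ 2) * (P.b * P.T - P.c / (P.T * P.q ^ 2)))) := by
      rw [← mul_assoc, div_mul_div_cancel₀ hq3, div_self (pow_ne_zero 2 hr), one_mul]
    rw [this, ← hk]
    ring
  · have h01 : (0 : Fin (P.d + 1)) ≠ i := by rintro rfl; simp at hi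
    rw [if_neg h01, Finsupp.single_eq_of_ne' h01, hi]
    ring
  · have h01 : (0 : Fin (P.d + 1)) ≠ i := by rintro rfl; simp at hi
    rw [if_neg h01, Finsupp.single_eq_of_ne' h01, hA.eigenbasis.tridiagonal i 0 (Or.inr hi)]
    ring

/-- Both A and Z send |θ*₀⟩ into the span of the first two vectors. The ratio of the second
coordinates is explicit, and `repr_zero_sub` for the exchanged pair fixes the first. -/
lemma A_plus : A (w 0) = (P.cs / P.q) • P.Z A As (w 0) +
    (P.c + P.b * P.T ^ 2 - P.cs * P.H / (P.q * P.T)) • w 0 := by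
  have hq := hP.q_ne_zero
  have hr := hP.r0_ne_zero
  have hb := hP.bs_ne_zero
  have hq3 := hP.sq_sub_inv_sq_ne_zero
  have hk := kappa_plus (H := P.H) hq hP.T_ne_zero hP.sub_inv_ne_zero hP.bc_eq hP.bs_ne_zero hP.bscs_eq
  have h0 : (P.θs 0 - P.θs 1) * (w.repr (A (w 0)) 0 - P.θ 0) = P.swap.φ 1 :=
    hA.swap.repr_zero_sub hP.swap
  have hθs : P.θs 0 = P.bs + P.cs := Admissible.θ_zero (P := P.swap)
  have hθs1 : P.θs 1 = P.bs * P.q ^ 2 + P.cs / P.q ^ 2 := Admissible.θ_one (P := P.swap)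
  have hφ : P.swap.φ 1 = rphi P.q P.T P.bs P.cs P.b P.c P.r0 P.H (P.q ^ 2) := by rw [φ, pow_one]; rfl
  rw [← hP.ω_eq, ← hθs, ← hφ, ← h0, ← Admissible.θ_zero, ← hθs1] at hk
  have hn : P.cs / P.q * (P.r0 ^ 2 / (P.q ^ 2 - P.q⁻¹ ^ 2)) =
      1 / (P.bs * P.q * (P.q ^ 2 - P.q⁻¹ ^ 2)) := by
    have h1 := hP.bscs_eq
    rw [eq_div_iff (pow_ne_zero 2 hr)] at h1
    generalize P.q ^ 2 - P.q⁻¹ ^ 2 = n at *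
    field_simp
    linear_combination h1
  have hlin : P.q * P.θs 1 - P.q⁻¹ * P.θs 0 = P.bs * P.q * (P.q ^ 2 - P.q⁻¹ ^ 2) := by
    rw [hθs, hθs1]; field_simp; ring
  apply w.repr.injective
  ext i
  simp only [map_add, map_smul, Finsupp.add_apply, Finsupp.smul_apply, smul_eq_mul,
    Z_repr_star _ _ hA, Module.Basis.repr_self]
  rw [← mul_assoc, hn]
  have hD : P.bs * P.q * (P.q ^ 2 - P.q⁻¹ ^ 2) ≠ 0 := by positivity
  rcases Nat.lt_trichotomy i 1 with hi | hi | hi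
  · obtain rfl : i = 0 := Fin.ext (by rw [Fin.val_zero]; omega)
    rw [if_pos rfl, Finsupp.single_eq_same, mul_one, mul_one, Fin.val_zero]
    apply mul_left_cancel₀ hD
    rw [mul_add, ← hk, ← hlin, ← mul_assoc, mul_one_div_cancel (by rw [hlin]; exact hD)]
    ring
  · have h01 : (0 : Fin (P.d + 1)) ≠ i := by rintro rfl; simp at hi
    rw [if_neg h01, Finsupp.single_eq_of_ne' h01, hi, Fin.val_zero, hlin, mul_zero,
      add_zero, mul_zero, add_zero, ← mul_assoc, one_div_mul_cancel hD, one_mul]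
  · have h01 : (0 : Fin (P.d + 1)) ≠ i := by rintro rfl; simp at hi
    rw [if_neg h01, Finsupp.single_eq_of_ne' h01, hA.eigenbasis_star.tridiagonal i 0 (Or.inr hi)]
    ring

end IsLeonardPair
end BetheLeonard

/-! ### Polynomial model of an operator satisfying the cubic relation -/

namespace BetheLeonard
open Polynomial

section AWModel
variable (q e₁ e₀ ν k₀ k₁ k₂ : ℂ)

/-- The polynomials representing the images of the powers of `Z` applied to a cyclic vector. -/
noncomputable def awSeq : ℕ → ℂ[X]
  | 0 => ν • X + k₀ • 1
  | 1 => (ν * q⁻¹ ^ 2) • X ^ 2 + k₁ • X + k₂ • 1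
  | n + 2 => (q ^ 2 + q⁻¹ ^ 2) • (X * awSeq (n + 1)) - X ^ 2 * awSeq n
      - ((q ^ 2 - q⁻¹ ^ 2) ^ 2) • awSeq n + e₁ • X ^ (n + 1) + e₀ • X ^ n

/-- The linear extension of `X ^ i ↦ awSeq i`. -/
noncomputable def awAct (p : ℂ[X]) : ℂ[X] :=
  ∑ i ∈ Finset.range (p.natDegree + 1), p.coeff i • awSeq q e₁ e₀ ν k₀ k₁ k₂ i

variable {q e₁ e₀ ν k₀ k₁ k₂}

section
variable {V : Type*} [AddCommGroup V] [Module ℂ V] {A Z : Module.End ℂ V} {Ω : V}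
  (hcubic : Z * (Z * A) - (q ^ 2 + q⁻¹ ^ 2) • (Z * (A * Z)) + A * (Z * Z) =
      (-(q ^ 2 - q⁻¹ ^ 2) ^ 2) • A + e₁ • Z + e₀ • (1 : Module.End ℂ V))
  (h0 : A Ω = ν • Z Ω + k₀ • Ω)
  (h1 : A (Z Ω) = (ν * q⁻¹ ^ 2) • Z (Z Ω) + k₁ • Z Ω + k₂ • Ω)
include hcubic h0 h1

/-- Applied to Zⁿ|Ω⟩, the cubic relation can be solved for A Zⁿ⁺²|Ω⟩; this is the recursion defining
`awSeq`. -/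
lemma aeval_awSeq (n : ℕ) :
    A ((Z ^ n) Ω) = aeval Z (awSeq q e₁ e₀ ν k₀ k₁ k₂ n) Ω := by
  induction n using Nat.strong_induction_on with
  | _ n ih =>
    match n with
    | 0 => simp [awSeq, h0]
    | 1 => simp [awSeq, h1, pow_two]
    | n + 2 =>
      have i0 := ih n (by omega)
      have i1 := ih (n + 1) (by omega)
      have hc := LinearMap.congr_fun hcubic ((Z ^ n) Ω)
      simp only [LinearMap.add_apply, LinearMap.sub_apply, LinearMap.smul_apply,
        Module.End.mul_apply, Module.End.one_apply] at hc
      have p1 : Z ((Z ^ n) Ω) = (Z ^ (n + 1)) Ω := by rw [pow_succ']; rfl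
      have p2 : Z (Z ((Z ^ n) Ω)) = (Z ^ (n + 2)) Ω := by rw [p1, pow_succ' Z (n + 1)]; rfl
      rw [p2, p1, i0, i1] at hc
      simp only [awSeq, map_add, map_sub, map_mul, map_smul, aeval_X, aeval_X_pow,
        LinearMap.add_apply, LinearMap.sub_apply, LinearMap.smul_apply, Module.End.mul_apply,
        pow_two Z]
      linear_combination (norm := module) hc

lemma aeval_awAct (p : ℂ[X]) :
    A (aeval Z p Ω) = aeval Z (awAct q e₁ e₀ ν k₀ k₁ k₂ p) Ω := by
  rw [awAct, aeval_eq_sum_range]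
  simp only [map_sum, LinearMap.sum_apply, map_smul, LinearMap.smul_apply,
    aeval_awSeq hcubic h0 h1]

end

/-- At a fixed z the recursion is linear with constant coefficients. Its homogeneous part is solved
by zdⁿ and zuⁿ, the inhomogeneous part by f₀zⁿ, and two initial values suffice. -/
lemma eval_awSeq {z zd zu f₁ f₂ f₀ : ℂ}
    (hzd : zd ^ 2 - (q ^ 2 + q⁻¹ ^ 2) * z * zd + z ^ 2 = -(q ^ 2 - q⁻¹ ^ 2) ^ 2)
    (hzu : zu ^ 2 - (q ^ 2 + q⁻¹ ^ 2) * z * zu + z ^ 2 = -(q ^ 2 - q⁻¹ ^ 2) ^ 2)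
    (hf₀ : (2 - (q ^ 2 + q⁻¹ ^ 2)) * z ^ 2 * f₀ = -(q ^ 2 - q⁻¹ ^ 2) ^ 2 * f₀ + e₁ * z + e₀)
    (h0 : f₁ + f₂ + f₀ = ν * z + k₀)
    (h1 : f₁ * zd + f₂ * zu + f₀ * z = ν * q⁻¹ ^ 2 * z ^ 2 + k₁ * z + k₂) (n : ℕ) :
    (awSeq q e₁ e₀ ν k₀ k₁ k₂ n).eval z = f₁ * zd ^ n + f₂ * zu ^ n + f₀ * z ^ n := by
  induction n using Nat.strong_induction_on with
  | _ n ih =>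
    match n with
    | 0 => simp [awSeq, h0]
    | 1 => simp [awSeq, h1]
    | n + 2 =>
      have i0 := ih n (by omega)
      have i1 := ih (n + 1) (by omega)
      simp only [awSeq, eval_add, eval_sub, eval_mul, eval_smul, smul_eq_mul, eval_X, eval_pow, i0, i1]
      linear_combination (-f₁ * zd ^ n) * hzd - f₂ * zu ^ n * hzu - z ^ n * hf₀

lemma eval_awAct {z zd zu f₁ f₂ f₀ : ℂ}
    (hzd : zd ^ 2 - (q ^ 2 + q⁻¹ ^ 2) * z * zd + z ^ 2 = -(q ^ 2 - q⁻¹ ^ 2) ^ 2)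
    (hzu : zu ^ 2 - (q ^ 2 + q⁻¹ ^ 2) * z * zu + z ^ 2 = -(q ^ 2 - q⁻¹ ^ 2) ^ 2)
    (hf₀ : (2 - (q ^ 2 + q⁻¹ ^ 2)) * z ^ 2 * f₀ = -(q ^ 2 - q⁻¹ ^ 2) ^ 2 * f₀ + e₁ * z + e₀)
    (h0 : f₁ + f₂ + f₀ = ν * z + k₀)
    (h1 : f₁ * zd + f₂ * zu + f₀ * z = ν * q⁻¹ ^ 2 * z ^ 2 + k₁ * z + k₂) (p : ℂ[X]) :
    (awAct q e₁ e₀ ν k₀ k₁ k₂ p).eval z = f₁ * p.eval zd + f₂ * p.eval zu + f₀ * p.eval z := by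
  rw [awAct, eval_finsetSum, eval_eq_sum_range, eval_eq_sum_range, eval_eq_sum_range]
  simp only [eval_smul, smul_eq_mul, eval_awSeq hzd hzu hf₀ h0 h1, Finset.mul_sum,
    ← Finset.sum_add_distrib]
  exact Finset.sum_congr rfl fun i _ => by ring

lemma natDegree_awSeq_le (n : ℕ) : (awSeq q e₁ e₀ ν k₀ k₁ k₂ n).natDegree ≤ n + 1 := by
  induction n using Nat.strong_induction_on with
  | _ n ih =>
    match n with
    | 0 => unfold awSeq; compute_degree
    | 1 => unfold awSeq; compute_degree
    | n + 2 =>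
      have i0 := ih n (by omega)
      have i1 := ih (n + 1) (by omega)
      unfold awSeq
      compute_degree
      omega

/-- The top coefficients obey a recursion with characteristic roots q² and q⁻²; the initial values
ν, νq⁻² select q⁻². -/
lemma coeff_awSeq (hq : q ≠ 0) (n : ℕ) :
    (awSeq q e₁ e₀ ν k₀ k₁ k₂ n).coeff (n + 1) = ν * q⁻¹ ^ (2 * n) := by
  induction n using Nat.strong_induction_on with
  | _ n ih =>
    match n with
    | 0 => simp [awSeq, coeff_one]
    | 1 => simp [awSeq, coeff_X, coeff_one]
    | n + 2 =>
      have i0 := ih n (by omega)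
      have i1 := ih (n + 1) (by omega)
      have hd := natDegree_awSeq_le (q := q) (e₁ := e₁) (e₀ := e₀) (ν := ν) (k₀ := k₀) (k₁ := k₁) (k₂ := k₂) n
      have : (awSeq q e₁ e₀ ν k₀ k₁ k₂ n).coeff (n + 2 + 1) = 0 :=
        coeff_eq_zero_of_natDegree_lt (by omega)
      simp only [awSeq, coeff_add, coeff_sub, coeff_smul, smul_eq_mul, coeff_X_mul, coeff_X_pow, i1, this]
      rw [show n + 2 + 1 = (n + 1) + 2 by ring, coeff_X_pow_mul, i0]
      rw [if_neg (by omega), if_neg (by omega)]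
      have e : q ^ 2 * q⁻¹ ^ 2 = 1 := by rw [← mul_pow, mul_inv_cancel₀ hq, one_pow]
      linear_combination ν * q⁻¹ ^ (2 * n) * e

lemma natDegree_awAct_le {p : ℂ[X]} {n : ℕ} (hp : p.natDegree ≤ n) :
    (awAct q e₁ e₀ ν k₀ k₁ k₂ p).natDegree ≤ n + 1 := by
  refine natDegree_sum_le_of_forall_le _ _ fun i hi => ?_
  refine (natDegree_smul_le _ _).trans ((natDegree_awSeq_le i).trans ?_)
  have := Finset.mem_range.1 hi
  omega

lemma coeff_awAct (hq : q ≠ 0) {p : ℂ[X]} {n : ℕ} (hp : p.natDegree ≤ n) :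
    (awAct q e₁ e₀ ν k₀ k₁ k₂ p).coeff (n + 1) = p.coeff n * (ν * q⁻¹ ^ (2 * n)) := by
  have h : awAct q e₁ e₀ ν k₀ k₁ k₂ p =
      ∑ i ∈ Finset.range (n + 1), p.coeff i • awSeq q e₁ e₀ ν k₀ k₁ k₂ i := by
    refine Finset.sum_subset (by simpa using hp) fun i _ hi => ?_
    rw [coeff_eq_zero_of_natDegree_lt (by simpa using hi), zero_smul]
  rw [h, finsetSum_coeff, Finset.sum_range_succ, Finset.sum_eq_zero, zero_add, coeff_smul,
    coeff_awSeq hq, smul_eq_mul]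
  intro i hi
  have := Finset.mem_range.1 hi
  have hd := natDegree_awSeq_le (q := q) (e₁ := e₁) (e₀ := e₀) (ν := ν) (k₀ := k₀) (k₁ := k₁)
    (k₂ := k₂) i
  rw [coeff_smul, coeff_eq_zero_of_natDegree_lt (hd.trans_lt (by omega)), smul_zero]

end AWModel
end BetheLeonard

/-! ### A as a q-difference operator on ℂ[Z]|Ω⟩ -/

namespace BetheLeonard
open Params Polynomial
variable {P : Params} {V : Type*} [AddCommGroup V] [Module ℂ V] {A As : Module.End ℂ V}
  {v w : Module.Basis (Fin (P.d + 1)) ℂ V}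

namespace Params
variable (P)

/-- The spectral coordinate `z = q U + q⁻¹ U⁻¹` at `U = u²`. -/
noncomputable def z (U : ℂ) : ℂ := P.q * U + (P.q * U)⁻¹

/-- The coefficient of the value at `q⁻² U` in the Askey-Wilson operator `act`. -/
noncomputable def f₁ (ε : ℤˣ) (U : ℂ) : ℂ :=
  if ε = 1 then rf1p P.q P.T P.b P.c P.bs P.cs P.H U else rf1m P.q P.T P.b P.c P.bs P.cs P.H U

/-- The coefficient of the value at `q² U` in the Askey-Wilson operator `act`. -/
noncomputable def f₂ (ε : ℤˣ) (U : ℂ) : ℂ :=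
  if ε = 1 then rf2p P.q P.T P.b P.c P.bs P.cs P.H U else rf2m P.q P.T P.b P.c P.bs P.cs P.H U

/-- The coefficient of the value at `U` in the Askey-Wilson operator `act`. -/
noncomputable def f₀ (U : ℂ) : ℂ := rf0 P.q P.T P.b P.c P.bs P.cs P.H U

/-- The coefficient of `Z` in `A|Ω^ε⟩`. -/
noncomputable def ν (ε : ℤˣ) : ℂ := if ε = 1 then P.cs / P.q else 0

/-- The constant coefficient in `A|Ω^ε⟩`. -/
noncomputable def k₀ (ε : ℤˣ) : ℂ :=
  if ε = 1 then P.c + P.b * P.T ^ 2 - P.cs * P.H / (P.q * P.T) else P.b + P.c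

/-- The coefficient of `Z` in `A Z|Ω^ε⟩`. -/
noncomputable def k₁ (ε : ℤˣ) : ℂ :=
  if ε = 1 then P.q⁻¹ ^ 2 * (P.c + P.b * P.T ^ 2 - P.cs * P.H / (P.q * P.T))
  else P.b * P.q ^ 2 + P.c / P.q ^ 2

/-- The constant coefficient in `A Z|Ω^ε⟩`. -/
noncomputable def k₂ (ε : ℤˣ) : ℂ :=
  if ε = 1 then ((P.q ^ 2 - P.q⁻¹ ^ 2) * (P.bs + P.cs) + (P.q - P.q⁻¹) *
    ((P.b * P.T + P.c / P.T) * P.H - P.N * (P.bs * P.T + P.cs / P.T))) / P.q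
  else (P.q - P.q⁻¹) * (P.bs * (1 - P.T ^ 2) + P.cs * ((P.T ^ 2)⁻¹ - 1))
        + P.H * (1 - P.q ^ 2) * (P.b * P.T - P.c / (P.T * P.q ^ 2))

/-- The Askey-Wilson operator by which `A` acts on `ℂ[Z]|Ω^ε⟩`. -/
noncomputable def act (ε : ℤˣ) (f : ℂ[X]) : ℂ[X] :=
  awAct P.q P.e₁ P.e₀ (P.ν ε) (P.k₀ ε) (P.k₁ ε) (P.k₂ ε) f

/-- The spectral points `u` at which the Askey-Wilson operator is regular. -/
structure Regular (u : ℂ) : Prop where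
  ne_zero : u ≠ 0
  b_sq : bfun (u ^ 2) ≠ 0
  b_q_sq : bfun (P.q * u ^ 2) ≠ 0
  b_q2_sq : bfun (P.q ^ 2 * u ^ 2) ≠ 0

variable {P}

lemma z_down (U : ℂ) : P.z (U / P.q ^ 2) = U / P.q + P.q / U := by
  unfold z; field_simp

lemma z_up (U : ℂ) :
    P.z (P.q ^ 2 * U) = P.q ^ 3 * U + (P.q ^ 3 * U)⁻¹ := by
  unfold z; ring_nf

/-- The denominator of f₀ is z² - (q + q⁻¹)², so this is f₀ with denominators cleared, in the form
that makes f₀zⁿ a particular solution of the recursion. -/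
lemma f₀_eq (hP : P.Admissible) {u : ℂ} (hu : P.Regular u) :
    (2 - (P.q ^ 2 + P.q⁻¹ ^ 2)) * P.z (u ^ 2) ^ 2 * P.f₀ (u ^ 2) =
      -(P.q ^ 2 - P.q⁻¹ ^ 2) ^ 2 * P.f₀ (u ^ 2) + P.e₁ * P.z (u ^ 2) + P.e₀ := by
  have hq := hP.q_ne_zero
  have hU : u ^ 2 ≠ 0 := pow_ne_zero 2 hu.ne_zero
  have h1 := hu.b_sq
  have h3 := hu.b_q2_sq
  have hb : bfun (u ^ 2) * bfun (P.q ^ 2 * u ^ 2) = P.z (u ^ 2) ^ 2 - (P.q + P.q⁻¹) ^ 2 := by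
    unfold bfun z; generalize u ^ 2 = U at *; field_simp; ring
  have e : P.q * P.q⁻¹ = 1 := mul_inv_cancel₀ hq
  have hf : P.f₀ (u ^ 2) * (P.z (u ^ 2) ^ 2 - (P.q + P.q⁻¹) ^ 2) =
      ((P.b * P.T + P.c / P.T) * P.H - P.N * (P.bs * P.T + P.cs / P.T)) * P.z (u ^ 2) +
    (P.q + P.q⁻¹) * ((P.bs * P.T + P.cs / P.T) * P.H - P.N * (P.b * P.T + P.c / P.T)) := by
    rw [← hb]
    unfold f₀ rf0
    exact div_mul_cancel₀ _ (mul_ne_zero h1 h3)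
  unfold e₁ e₀
  linear_combination (-(P.q - P.q⁻¹) ^ 2) * hf - 2 * P.z (u ^ 2) ^ 2 * P.f₀ (u ^ 2) * e

end Params

/-- `|Ω^ε⟩` generates `V` over `ℂ[Z]`, and `A` acts there through `act`. -/
lemma IsLeonardPair.cyclic (hA : IsLeonardPair P A As v w) (hP : P.Admissible) (ε : ℤˣ) (x : V) :
    ∃ f : ℂ[X], aeval (P.Z A As) f (refState P v w ε) = x := by
  unfold refState
  split_ifs
  · exact hA.cyclic_plus hP x
  · exact hA.cyclic_minus hP x

/-- The relation for [A, [A*, A]_q]_q on |θ*₀⟩: the shift in `Z` absorbs the ωA term, and A* acts by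
the scalar θ*₀. -/
lemma IsLeonardPair.A_Z_plus (hA : IsLeonardPair P A As v w) (hP : P.Admissible) :
    A (P.Z A As (w 0)) = P.q⁻¹ ^ 2 • P.Z A As (A (w 0)) + P.k₂ 1 • w 0 := by
  have hq := hP.q_ne_zero
  have hr := hP.r0_ne_zero
  have h1 := hP.sub_inv_ne_zero
  have h2 := hP.add_inv_ne_zero
  have hθs : P.θs 0 = P.bs + P.cs := Admissible.θ_zero (P := P.swap)
  have hAs : As (w 0) = P.θs 0 • w 0 := hA.eigenbasis_star.eigen 0
  have h := LinearMap.congr_fun (hA.askeyWilson.qComm_A hq) (w 0)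
  have hf : P.q ^ 2 - P.q⁻¹ ^ 2 = (P.q - P.q⁻¹) * (P.q + P.q⁻¹) := by ring
  have hη : P.η = (P.q + P.q⁻¹) * P.e₁ / P.r0 ^ 2 := by rw [← hP.η_e₁]; field_simp
  have hρ : P.ρ = -(P.q ^ 2 - P.q⁻¹ ^ 2) ^ 2 / P.r0 ^ 2 := by rw [← hP.ρ_eq]; field_simp
  have hk : P.k₂ 1 = ((P.q ^ 2 - P.q⁻¹ ^ 2) * P.θs 0 - P.e₁ / (P.q - P.q⁻¹)) / P.q := by
    unfold k₂ e₁; rw [if_pos rfl, hθs]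
    generalize P.q - P.q⁻¹ = m at *
    field_simp
    ring
  rw [hk]
  unfold Z
  generalize qComm P.q As A = K at *
  rw [qComm, hη, hρ, hf] at h
  rw [hf]
  simp only [LinearMap.sub_apply, LinearMap.smul_apply, Module.End.mul_apply, map_smul,
    LinearMap.add_apply, map_add, LinearMap.neg_apply, Module.End.one_apply, hAs] at h ⊢
  have e : P.q⁻¹ ^ 2 = 1 - (P.q - P.q⁻¹) / P.q := by field_simp; ring
  have e' : P.q⁻¹ = P.q - (P.q - P.q⁻¹) := by ring
  rw [e]
  nth_rewrite 1 [e'] at h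
  generalize P.q - P.q⁻¹ = m at *
  generalize P.q + P.q⁻¹ = n at *
  linear_combination (norm := skip) (P.r0 ^ 2 / (m * n) / P.q) • h
  match_scalars <;> field_simp <;> ring

lemma IsLeonardPair.apply_aeval (hA : IsLeonardPair P A As v w) (hP : P.Admissible) (ε : ℤˣ)
    (f : ℂ[X]) : A (aeval (P.Z A As) f (refState P v w ε)) =
      aeval (P.Z A As) (P.act ε f) (refState P v w ε) := by
  refine aeval_awAct (hA.askeyWilson.cubic hP) ?_ ?_ f
  · unfold refState ν k₀
    split_ifs
    · exact hA.A_plus hP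
    · rw [zero_smul, zero_add, ← Admissible.θ_zero]; exact hA.eigenbasis.eigen 0
  · unfold refState
    rcases eq_or_ne ε 1 with rfl | hε
    · rw [if_pos rfl, hA.A_Z_plus hP, hA.A_plus hP]
      unfold ν k₁
      simp only [if_true, map_add, map_smul]
      module
    · rw [if_neg hε, hA.A_Z_minus hP, Admissible.θ_one]
      simp [ν, k₁, k₂, hε]

lemma Params.eval_act (hP : P.Admissible) (ε : ℤˣ) (f : ℂ[X]) {u : ℂ} (hu : P.Regular u) :
    (P.act ε f).eval (P.z (u ^ 2)) = P.f₁ ε (u ^ 2) * f.eval (P.z (u ^ 2 / P.q ^ 2)) +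
      P.f₂ ε (u ^ 2) * f.eval (P.z (P.q ^ 2 * u ^ 2)) + P.f₀ (u ^ 2) * f.eval (P.z (u ^ 2)) := by
  have hq := hP.q_ne_zero
  have hT := hP.T_ne_zero
  have hU : u ^ 2 ≠ 0 := pow_ne_zero 2 hu.ne_zero
  refine eval_awAct ?_ ?_ (f₀_eq hP hu) ?_ ?_ f
  · unfold z; generalize u ^ 2 = U at *; field_simp; ring
  · unfold z; generalize u ^ 2 = U at *; field_simp; ring
  · unfold Params.f₁ Params.f₂ f₀ ν k₀
    split_ifs
    · exact rf_sum_plus hq hT hU hu.b_sq hu.b_q_sq hu.b_q2_sq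
    · rw [zero_mul, zero_add]
      exact rf_sum_minus hq hT hU hu.b_sq hu.b_q_sq hu.b_q2_sq
  · rw [z_down, z_up]
    unfold Params.f₁ Params.f₂ f₀ ν k₁ k₂
    split_ifs
    · have := rf_mul_plus (b := P.b) (c := P.c) (bs := P.bs) (cs := P.cs) (H := P.H)
        hq hT hU hu.b_sq hu.b_q_sq hu.b_q2_sq
      unfold z N
      rw [this]; ring
    · have := rf_mul_minus (b := P.b) (c := P.c) (bs := P.bs) (cs := P.cs) (H := P.H)
        hq hT hU hu.b_sq hu.b_q_sq hu.b_q2_sq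
      unfold z
      rw [this]; ring

end BetheLeonard

/-! ### The polynomial annihilating Z -/

namespace BetheLeonard
open Params Polynomial
variable {P : Params} {V : Type*} [AddCommGroup V] [Module ℂ V] {A As : Module.End ℂ V}
  {v w : Module.Basis (Fin (P.d + 1)) ℂ V}

namespace Params
variable (P)

/-- The half-integer power `q^{1/2 + j - s}`. -/
noncomputable def hp (j : ℕ) : ℂ := P.p ^ (1 + 2 * (j : ℤ) - (P.d : ℤ))

/-- The polynomial with roots `q^{2j-2s} ζ² + q^{2s-2j} ζ⁻²`. -/
noncomputable def gridPoly : ℂ[X] :=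
  ∏ j ∈ Finset.range (P.d + 1), (X - C ((P.q ^ 2) ^ j / P.T * P.ζ ^ 2 + P.T / ((P.q ^ 2) ^ j * P.ζ ^ 2)))

variable {P}

lemma gridPoly_monic : P.gridPoly.Monic := monic_prod_X_sub_C _ _

lemma natDegree_gridPoly : P.gridPoly.natDegree = P.d + 1 := by
  unfold gridPoly; rw [natDegree_finsetProd_X_sub_C_eq_card, Finset.card_range]

namespace Admissible
variable (hP : P.Admissible)
include hP

lemma p_ne_zero : P.p ≠ 0 := by
  intro h; have := hP.p_sq; rw [h] at this; exact hP.q_ne_zero (by rw [← this]; simp)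

lemma T_eq_p : P.T = P.p ^ (2 * (P.d : ℤ)) := by
  rw [T, ← hP.p_sq, zpow_mul]; norm_cast

lemma hp_ne_zero (j : ℕ) : P.hp j ≠ 0 := zpow_ne_zero _ hP.p_ne_zero

lemma hp_sq (j : ℕ) : P.hp j ^ 2 = P.q * (P.q ^ 2) ^ j / P.T := by
  have hp0 := hP.p_ne_zero
  rw [hP.T_eq_p, ← hP.p_sq, hp, eq_div_iff (zpow_ne_zero _ hp0), ← zpow_natCast, ← zpow_mul,
    ← zpow_add₀ hp0, ← pow_mul, ← pow_mul, ← pow_add, ← zpow_natCast]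
  congr 1; push_cast; ring

lemma hp_mul {i j : ℕ} (h : i + j = P.d) : P.hp i * P.hp j = P.q := by
  have hp0 := hP.p_ne_zero
  rw [hp, hp, ← zpow_add₀ hp0, ← hP.p_sq, ← h, ← zpow_natCast]
  congr 1; push_cast; ring

lemma bfun_mul_bfun {u : ℂ} (hu : u ≠ 0) {t : ℂ} (ht : t ≠ 0) :
    bfun (t * u * P.ζ) * bfun (t * u * P.ζ⁻¹) = gridF (t ^ 2) P.H (u ^ 2) := by
  have := hP.ζ_ne_zero
  unfold bfun gridF H
  field_simp
  ring

/-- Each root pairs the half-power at i with that at j = 2s - i, whose product is q. Reversing the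
order in one of the two products regroups the factors. -/
lemma gridPoly_eval {u : ℂ} (hu : u ≠ 0) : P.gridPoly.eval (P.z (u ^ 2)) =
    ∏ j ∈ Finset.range (P.d + 1), (bfun (P.hp j * u * P.ζ) * bfun (P.hp j * u * P.ζ⁻¹)) := by
  have hz := hP.ζ_ne_zero
  have hq := hP.q_ne_zero
  rw [Finset.prod_mul_distrib, ← Finset.prod_range_reflect, ← Finset.prod_mul_distrib, gridPoly,
    eval_prod]
  rw [← Finset.prod_range_reflect]
  refine Finset.prod_congr rfl fun j hj => ?_
  have hj' : j ≤ P.d := by have := Finset.mem_range.1 hj; omega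
  rw [Nat.add_sub_cancel]
  generalize hi : P.d - j = i
  have hm := hP.hp_mul (show i + j = P.d by omega)
  have hs := hP.hp_sq i
  have hi0 := hP.hp_ne_zero i
  have hj0 := hP.hp_ne_zero j
  rw [eval_sub, eval_X, eval_C, z]
  have e1 : (P.q ^ 2) ^ i / P.T = P.hp i / P.hp j := by
    rw [eq_div_iff hj0]
    apply mul_left_cancel₀ hq
    rw [← mul_assoc, ← mul_div_assoc, ← hs, sq, mul_assoc, hm, mul_comm]
  have e2 : P.T / ((P.q ^ 2) ^ i * P.ζ ^ 2) = P.hp j / (P.hp i * P.ζ ^ 2) := by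
    rw [← div_div, ← inv_div ((P.q ^ 2) ^ i), e1, inv_div, div_div]
  rw [e1, e2, ← hm]
  unfold bfun
  field_simp
  ring

lemma gridPoly_eval' {u : ℂ} (hu : u ≠ 0) : P.gridPoly.eval (P.z (u ^ 2)) =
    ∏ j ∈ Finset.range (P.d + 1), gridF (P.q * (P.q ^ 2) ^ j / P.T) P.H (u ^ 2) := by
  rw [hP.gridPoly_eval hu]
  exact Finset.prod_congr rfl fun j _ => by rw [hP.bfun_mul_bfun hu (hP.hp_ne_zero j), hP.hp_sq]

/-- The shift moves every grid factor to the next one, so the two products differ only at their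
ends. -/
lemma gridPoly_eval_up {u : ℂ} (hu : u ≠ 0) :
    P.gridPoly.eval (P.z (P.q ^ 2 * u ^ 2)) * gridF (P.q / P.T) P.H (u ^ 2) =
      P.gridPoly.eval (P.z (u ^ 2)) * gridF (P.q ^ 3 * P.T) P.H (u ^ 2) := by
  have hq := hP.q_ne_zero
  have h : ∀ t, gridF t P.H ((P.q * u) ^ 2) = gridF (t * P.q ^ 2) P.H (u ^ 2) := fun t => by
    unfold gridF; ring_nf
  rw [← mul_pow, hP.gridPoly_eval' hu, hP.gridPoly_eval' (mul_ne_zero hq hu)]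
  have h2 : ∀ j : ℕ, P.q * (P.q ^ 2) ^ j / P.T * P.q ^ 2 = P.q * (P.q ^ 2) ^ (j + 1) / P.T :=
    fun j => by ring
  simp only [h, h2]
  have h0 := Finset.prod_range_succ' (fun j => gridF (P.q * (P.q ^ 2) ^ j / P.T) P.H (u ^ 2)) (P.d + 1)
  rw [Finset.prod_range_succ] at h0
  have h3 : P.q * (P.q ^ 2) ^ (P.d + 1) / P.T = P.q ^ 3 * P.T := by
    rw [T, zpow_natCast]; field_simp; ring
  rw [h3, pow_zero, mul_one] at h0
  exact h0.symm

lemma gridPoly_eval_down {u : ℂ} (hu : u ≠ 0) :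
    P.gridPoly.eval (P.z (u ^ 2 / P.q ^ 2)) * gridF (P.q * P.T) P.H (u ^ 2) =
      P.gridPoly.eval (P.z (u ^ 2)) * gridF (1 / (P.q * P.T)) P.H (u ^ 2) := by
  have hq := hP.q_ne_zero
  have hT := hP.T_ne_zero
  have h : ∀ t, gridF t P.H (u ^ 2) = gridF (t * P.q ^ 2) P.H (u ^ 2 / P.q ^ 2) := fun t => by
    unfold gridF; field_simp
  have := hP.gridPoly_eval_up (div_ne_zero hu hq)
  rw [div_pow, mul_div_cancel₀ _ (pow_ne_zero 2 hq)] at this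
  rw [h, h, show P.q * P.T * P.q ^ 2 = P.q ^ 3 * P.T by ring,
    show 1 / (P.q * P.T) * P.q ^ 2 = P.q / P.T by field_simp]
  exact this.symm

/-- Lets polynomial identities be checked at regular points: solving for u by square roots, only the
values ±2 and ±(q + q⁻¹) of z have to be excluded. -/
lemma infinite_regular : {x : ℂ | ∃ u, P.Regular u ∧ P.z (u ^ 2) = x}.Infinite := by
  have hq := hP.q_ne_zero
  have hf : ({2, -2, P.q + P.q⁻¹, -(P.q + P.q⁻¹)} : Set ℂ).Finite := by simp
  refine hf.infinite_compl.mono fun x hx => ?_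
  simp only [Set.mem_compl_iff, Set.mem_insert_iff, Set.mem_singleton_iff, not_or] at hx
  obtain ⟨s, hs⟩ := IsAlgClosed.exists_pow_nat_eq (x ^ 2 - 4) (n := 2) (by norm_num)
  have ht : ((x + s) / 2) ^ 2 - x * ((x + s) / 2) + 1 = 0 := by linear_combination hs / 4
  generalize (x + s) / 2 = t at ht
  have ht0 : t ≠ 0 := by rintro rfl; simp at ht
  obtain ⟨u, hu⟩ := IsAlgClosed.exists_pow_nat_eq (t / P.q) (n := 2) (by norm_num)
  have hu0 : u ≠ 0 := by
    rintro rfl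
    rw [zero_pow two_ne_zero, eq_comm, div_eq_zero_iff] at hu
    tauto
  have hxt : x = t + t⁻¹ := by field_simp; linear_combination -ht
  have key : ∀ y : ℂ, y ≠ 0 → bfun y = 0 → y = 1 ∨ y = -1 := by
    intro y hy h
    rw [bfun_eq hy, div_eq_zero_iff, or_iff_left hy] at h
    exact sq_eq_one_iff.1 (sub_eq_zero.1 h)
  have hx2 : t ≠ 1 ∧ t ≠ -1 := by
    refine ⟨?_, ?_⟩ <;> rintro rfl
    · exact hx.1 (by rw [hxt]; norm_num)
    · exact hx.2.1 (by rw [hxt]; norm_num)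
  have e1 : P.q * u ^ 2 = t := by rw [hu]; field_simp
  have e2 : P.q ^ 2 * u ^ 2 = P.q * t := by rw [hu]; field_simp
  refine ⟨u, ⟨hu0, fun h => ?_, fun h => ?_, fun h => ?_⟩, ?_⟩
  · have e3 : t = P.q * u ^ 2 := e1.symm
    rcases key _ (pow_ne_zero 2 hu0) h with h | h <;> rw [h] at e3
    · exact hx.2.2.1 (by rw [hxt, e3, mul_one])
    · exact hx.2.2.2 (by rw [hxt, e3, mul_neg_one, inv_neg]; ring)
  · rw [e1] at h
    rcases key _ ht0 h with h | h
    · exact hx2.1 h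
    · exact hx2.2 h
  · rw [e2] at h
    rcases key _ (mul_ne_zero hq ht0) h with h | h
    · have : t = P.q⁻¹ := by exact eq_inv_of_mul_eq_one_right h
      exact hx.2.2.1 (by rw [hxt, this, inv_inv, add_comm])
    · have : t = -P.q⁻¹ := by rw [← neg_eq_iff_eq_neg]; exact eq_inv_of_mul_eq_one_right (by linear_combination -h)
      exact hx.2.2.2 (by rw [hxt, this, inv_neg, inv_inv]; ring)
  · rw [z, e1, hxt]

/-- Each shifted value of `gridPoly` exchanges the grid factor in its coefficient, after which
`rf_sum_minus_shift` sums the coefficients. -/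
lemma act_gridPoly : P.act (-1) P.gridPoly = C (P.θ (P.d + 1)) * P.gridPoly := by
  have hq := hP.q_ne_zero
  have hT := hP.T_ne_zero
  refine eq_of_infinite_eval_eq _ _ (hP.infinite_regular.mono ?_)
  rintro _ ⟨u, hu, rfl⟩
  have hU : u ^ 2 ≠ 0 := pow_ne_zero 2 hu.ne_zero
  have hs := rf_sum_minus_shift (b := P.b) (c := P.c) (bs := P.bs) (cs := P.cs) (H := P.H)
    hq hT hU hu.b_sq hu.b_q_sq hu.b_q2_sq
  have hθ : P.θ (P.d + 1) = P.b * (P.q * P.T) ^ 2 + P.c / (P.q * P.T) ^ 2 := by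
    have : (P.q ^ 2) ^ (P.d + 1) = (P.q * P.T) ^ 2 := by rw [T, zpow_natCast]; ring
    rw [θ_eq, this]
  have hup := hP.gridPoly_eval_up hu.ne_zero
  have hdown := hP.gridPoly_eval_down hu.ne_zero
  change (P.act (-1) P.gridPoly).eval (P.z (u ^ 2)) = _
  rw [eval_act hP _ _ hu, eval_mul, eval_C, hθ, ← hs]
  unfold Params.f₁ Params.f₂ f₀
  rw [if_neg (by decide), if_neg (by decide), rf1m_eq hq hT hU, rf2m_eq hq hT hU]
  linear_combination ((u ^ 2 * P.c / P.T + P.cs / P.T + P.bs * P.T + P.b * P.T / u ^ 2) /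
    (bfun (u ^ 2) * bfun (P.q * u ^ 2))) * hdown + ((P.q ^ 2)⁻¹ * (P.q ^ 4 * P.b * P.T * u ^ 2 +
      P.q ^ 2 * (P.bs * P.T + P.cs / P.T) + P.c / (P.T * u ^ 2)) /
      (bfun (P.q * u ^ 2) * bfun (P.q ^ 2 * u ^ 2))) * hup

/-- The value `θ_{2s+1}` cannot be repeated for both the data and the reversed data. -/
lemma θ_last_ne_or : (∀ i ≤ P.d, P.θ (P.d + 1) ≠ P.θ i) ∨
    (∀ i ≤ P.d, P.flip.θ (P.d + 1) ≠ P.flip.θ i) := by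
  have hq := hP.q_ne_zero
  by_contra! h
  obtain ⟨⟨i, hi, h1⟩, j, hj, h2⟩ := h
  have key : ∀ {R : Params}, R.Admissible → R.d = P.d → R.q = P.q → ∀ k ≤ P.d,
      R.θ (P.d + 1) = R.θ k → R.b * P.q ^ (2 * (P.d + 1 + k)) = R.c := by
    intro R hR hRd hRq k hk h
    rw [θ_eq, θ_eq, hRq] at h
    have hne : P.q ^ (2 * (P.d + 1 - k)) ≠ 1 := hP.q_not_root_of_unity _ (by omega)
    have e1 : (P.q ^ 2) ^ (P.d + 1) = (P.q ^ 2) ^ k * P.q ^ (2 * (P.d + 1 - k)) := by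
      rw [← pow_mul, ← pow_mul, ← pow_add]; congr 1; omega
    have e2 : P.q ^ (2 * (P.d + 1 + k)) = (P.q ^ 2) ^ k * ((P.q ^ 2) ^ k * P.q ^ (2 * (P.d + 1 - k))) := by
      rw [← pow_mul, ← pow_add, ← pow_add]; congr 1; omega
    have hQ : (P.q ^ 2) ^ k ≠ 0 := by positivity
    have hW : P.q ^ (2 * (P.d + 1 - k)) ≠ 0 := by positivity
    rw [e1] at h
    rw [e2]
    generalize (P.q ^ 2) ^ k = Q at *
    generalize P.q ^ (2 * (P.d + 1 - k)) = W at *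
    field_simp at h
    apply mul_left_cancel₀ (sub_ne_zero.2 hne)
    linear_combination h
  have k1 := key hP rfl rfl i hi h1
  have k2 : P.c * P.q ^ (-(2 * (P.d : ℤ))) * P.q ^ (2 * (P.d + 1 + j)) = P.b * P.q ^ (2 * (P.d : ℤ)) :=
    key hP.flip rfl rfl j hj h2
  rw [← k1] at k2
  have e1 : P.q ^ (2 * (P.d : ℤ)) = P.q ^ (2 * P.d) := by norm_cast
  rw [zpow_neg, e1] at k2
  have hb := hP.b_ne_zero
  have hD : P.q ^ (2 * P.d) ≠ 0 := by positivity
  apply hP.q_not_root_of_unity (2 * (i + j + 2)) (by omega)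
  have e2 : P.q ^ (2 * (P.d + 1 + i)) * P.q ^ (2 * (P.d + 1 + j)) =
      P.q ^ (2 * P.d) * (P.q ^ (2 * P.d) * P.q ^ (2 * (i + j + 2))) := by
    rw [← pow_add, ← pow_add, ← pow_add]; congr 1; ring
  have e3 : P.b * P.q ^ (2 * (P.d + 1 + i)) * (P.q ^ (2 * P.d))⁻¹ * P.q ^ (2 * (P.d + 1 + j)) =
      P.b * P.q ^ (2 * P.d) * P.q ^ (2 * (i + j + 2)) := by
    field_simp
    linear_combination e2
  rw [e3] at k2
  exact mul_left_cancel₀ (mul_ne_zero hb hD) (by rw [k2, mul_one])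

end Admissible
end Params

/-- `gridPoly(Z)|θ₀⟩` satisfies the eigenvector equation of A for a value outside its spectrum, so
it vanishes; cyclicity spreads this to all of V. -/
lemma IsLeonardPair.aeval_gridPoly_of_ne (hA : IsLeonardPair P A As v w) (hP : P.Admissible)
    (h : ∀ i ≤ P.d, P.θ (P.d + 1) ≠ P.θ i) : aeval (P.Z A As) P.gridPoly = 0 := by
  have h1 := hA.apply_aeval hP (-1) P.gridPoly
  have hr : refState P v w (-1) = v 0 := if_neg (by decide)
  rw [hP.act_gridPoly, hr, map_mul, aeval_C, Module.End.mul_apply, Module.algebraMap_end_apply] at h1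
  have h0 : aeval (P.Z A As) P.gridPoly (v 0) = 0 := by
    apply v.repr.injective
    ext i
    have h2 := congrArg (fun x => v.repr x i) h1
    simp only [hA.eigenbasis.repr_apply, map_smul, Finsupp.smul_apply, smul_eq_mul] at h2
    have h3 := h i (Nat.lt_succ_iff.1 i.2)
    rw [LinearEquiv.map_zero, Finsupp.zero_apply]
    by_contra hne
    exact h3 (mul_right_cancel₀ hne h2).symm
  ext x
  obtain ⟨f, rfl⟩ := hA.cyclic_minus hP x
  rw [← Module.End.mul_apply, ← map_mul, mul_comm, map_mul, Module.End.mul_apply, h0, map_zero,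
    LinearMap.zero_apply]

/-- If θ_{2s+1} collides with an eigenvalue, the reversed sequence is used: its extension does not
collide, and `Z` and `gridPoly` are unaffected by reversal. -/
lemma IsLeonardPair.aeval_gridPoly (hA : IsLeonardPair P A As v w) (hP : P.Admissible) :
    aeval (P.Z A As) P.gridPoly = 0 := by
  rcases hP.θ_last_ne_or with h | h
  · exact hA.aeval_gridPoly_of_ne hP h
  · have h1 : aeval (P.flip.Z A As) P.flip.gridPoly = 0 :=
      (hA.flip hP).aeval_gridPoly_of_ne hP.flip h
    have hZ : P.flip.Z A As = P.Z A As := by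
      unfold Z; rw [hP.ω_flip]; rfl
    rw [hZ] at h1
    exact h1

end BetheLeonard

/-! ### Row operations and minors along the last row -/

namespace BetheLeonard
open Matrix

section LinearAlgebra
variable {d : ℕ} {T : Matrix (Fin (d + 1)) (Fin (d + 1)) ℂ} {X : Fin (d + 1) → ℂ}

lemma exists_isUnit_lastRow_eq {y : Fin (d + 1) → ℂ} (hy : y ≠ 0) :
    ∃ W : Matrix (Fin (d + 1)) (Fin (d + 1)) ℂ, W.det ≠ 0 ∧ W (Fin.last d) = y := by
  obtain ⟨i, hi⟩ := Function.ne_iff.1 hy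
  refine ⟨((1 : Matrix _ _ ℂ).updateRow i y).submatrix (Equiv.swap i (Fin.last d)) id, ?_, ?_⟩
  · have h1 : ((1 : Matrix (Fin (d + 1)) (Fin (d + 1)) ℂ).updateRow i y).det = y i := by
      have := det_updateRow_sum (1 : Matrix (Fin (d + 1)) (Fin (d + 1)) ℂ) i y
      have h2 : (∑ k, y k • (1 : Matrix (Fin (d + 1)) (Fin (d + 1)) ℂ) k) = y := by
        ext j; simp [Finset.sum_apply, Matrix.one_apply]
      rw [h2, det_one, smul_eq_mul, mul_one] at this
      exact this
    rw [det_permute, h1]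
    exact mul_ne_zero (by simp) hi
  · ext j
    simp

lemma adjugate_last (M : Matrix (Fin (d + 1)) (Fin (d + 1)) ℂ) (k : Fin (d + 1)) :
    M.adjugate k (Fin.last d) = (-1) ^ (d + (k : ℕ)) * lastRowMinor M k := by
  rw [adjugate_fin_succ_eq_det_submatrix, Fin.val_last, lastRowMinor]

lemma lastRowMinor_updateRow (M : Matrix (Fin (d + 1)) (Fin (d + 1)) ℂ) (r : Fin (d + 1) → ℂ)
    (k : Fin (d + 1)) : lastRowMinor (M.updateRow (Fin.last d) r) k = lastRowMinor M k := by
  unfold lastRowMinor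
  congr 1
  ext i j
  simp [updateRow_apply]

lemma lastRowMinor_diagonal_mul (δ : Fin (d + 1) → ℂ) (M : Matrix (Fin (d + 1)) (Fin (d + 1)) ℂ)
    (k : Fin (d + 1)) :
    lastRowMinor (diagonal δ * M) k = (∏ i : Fin d, δ i.castSucc) * lastRowMinor M k := by
  unfold lastRowMinor
  rw [show (diagonal δ * M).submatrix (Fin.last d).succAbove k.succAbove =
    diagonal (fun i : Fin d => δ i.castSucc) * M.submatrix (Fin.last d).succAbove k.succAbove by
      ext i j; simp [diagonal_mul], det_mul, det_diagonal]

/-- If the kernel of `T` is spanned by `X`, and the last row of `T` vanishes, then the signed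
minors along the last row are a non-zero multiple of `X`. -/
lemma exists_lastRowMinor_eq (hX : X ≠ 0) (hker : ∀ Y, T *ᵥ Y = 0 → ∃ a : ℂ, Y = a • X)
    (hrow : ∀ k, T (Fin.last d) k = 0) :
    ∃ a : ℂ, a ≠ 0 ∧ ∀ k : Fin (d + 1), (-1) ^ (d + (k : ℕ)) * lastRowMinor T k = a * X k := by
  have hdet : T.det = 0 := det_eq_zero_of_row_eq_zero _ hrow
  obtain ⟨a, ha⟩ := hker (fun k => T.adjugate k (Fin.last d)) (by
    ext i
    have := congrFun (congrFun (mul_adjugate T) i) (Fin.last d)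
    rw [hdet, zero_smul] at this
    exact this)
  have ha' : ∀ k : Fin (d + 1), (-1) ^ (d + (k : ℕ)) * lastRowMinor T k = a * X k := fun k => by
    rw [← adjugate_last]; exact congrFun ha k
  refine ⟨a, ?_, ha'⟩
  rintro rfl
  obtain ⟨j, hj⟩ := Function.ne_iff.1 hX
  -- If all minors vanished, this matrix would be singular; a kernel vector would be a multiple of X
  -- with zero j-th entry, although X j ≠ 0.
  let S := T.updateRow (Fin.last d) (Pi.single j 1)
  have hS0 : S.det = 0 := by
    have := congrFun (congrFun (mul_adjugate S) (Fin.last d)) (Fin.last d)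
    rw [mul_apply] at this
    simp only [adjugate_last, S, lastRowMinor_updateRow, ha'] at this
    simpa using this.symm
  obtain ⟨Y, hY0, hY⟩ := exists_mulVec_eq_zero_iff.2 hS0
  have hTY : T *ᵥ Y = 0 := by
    ext i
    by_cases hi : i = Fin.last d
    · subst hi; simp [mulVec, dotProduct, hrow]
    · have := congrFun hY i
      simpa [S, mulVec, updateRow_ne hi] using this
  obtain ⟨c, rfl⟩ := hker Y hTY
  have hc : c * X j = 0 := by
    have := congrFun hY (Fin.last d)
    simpa [S, mulVec, updateRow_self] using this
  have : c = 0 := (mul_eq_zero.1 hc).resolve_right hj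
  exact hY0 (by simp [this])

/-- Row operations bring a matrix with one-dimensional kernel `ℂ X` to a form in which the last row
vanishes and `X` is given by the signed minors along the last row. -/
lemma exists_rowOperations (hX : X ≠ 0) (hker : ∀ Y, T *ᵥ Y = 0 → ∃ a : ℂ, Y = a • X)
    (hTX : T *ᵥ X = 0) {ψ : ℂ} (hψ : ψ ≠ 0) (hψ0 : d = 0 → ψ = -X 0) :
    ∃ W : Matrix (Fin (d + 1)) (Fin (d + 1)) ℂ, W.det ≠ 0 ∧
      (∀ k, (W * T) (Fin.last d) k = 0) ∧
      ∀ k, X k = ψ * (-1) ^ ((k : ℕ) + 1) * lastRowMinor (W * T) k := by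
  have hdet : T.det = 0 := exists_mulVec_eq_zero_iff.1 ⟨X, hX, hTX⟩
  obtain ⟨y, hy, hyT⟩ := exists_vecMul_eq_zero_iff.2 hdet
  obtain ⟨W₀, hW₀, hlast⟩ := exists_isUnit_lastRow_eq hy
  have hrow : ∀ k, (W₀ * T) (Fin.last d) k = 0 := fun k => by
    have := congrFun hyT k
    rw [← hlast] at this
    exact this
  -- For size one the minor is the empty determinant 1, so no row is left to rescale and ψ itself
  -- must be -X 0.
  rcases d with _ | n
  · refine ⟨W₀, hW₀, hrow, fun k => ?_⟩
    obtain rfl : k = 0 := Fin.fin_one_eq_zero k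
    rw [hψ0 rfl]
    simp [lastRowMinor]
  obtain ⟨a, ha, hmin⟩ := exists_lastRowMinor_eq (T := W₀ * T) hX (fun Y hY => hker Y (by
    rw [← mulVec_mulVec] at hY
    by_contra hne
    exact hW₀ (exists_mulVec_eq_zero_iff.1 ⟨_, hne, hY⟩))) hrow
  let t : ℂ := ((-1) ^ (n + 1 + 1) * ψ * a)⁻¹
  have ht : t ≠ 0 := inv_ne_zero (by simp [hψ, ha])
  -- Row 0 is not the last row here, so scaling it multiplies every minor by t and leaves the zero
  -- row alone.
  let δ : Fin (n + 1 + 1) → ℂ := fun i => if i = 0 then t else 1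
  refine ⟨diagonal δ * W₀, ?_, fun k => ?_, fun k => ?_⟩
  · rw [det_mul, det_diagonal]
    refine mul_ne_zero (Finset.prod_ne_zero_iff.2 fun i _ => ?_) hW₀
    by_cases hi : i = 0 <;> simp [δ, hi, ht]
  · rw [Matrix.mul_assoc, diagonal_mul, hrow, mul_zero]
  · have hprod : ∏ i : Fin (n + 1), δ i.castSucc = t := by
      rw [Fin.prod_univ_succ]; simp [δ, Fin.succ_ne_zero]
    rw [Matrix.mul_assoc, lastRowMinor_diagonal_mul, hprod]
    have h1 := hmin k
    have h2 : ψ * (-1) ^ (n + 1 + 1) * t * a = 1 := by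
      have : (-1 : ℂ) ^ (n + 1 + 1) * ψ * a ≠ 0 := by simp [hψ, ha]
      change ψ * (-1) ^ (n + 1 + 1) * ((-1) ^ (n + 1 + 1) * ψ * a)⁻¹ * a = 1
      linear_combination mul_inv_cancel₀ this
    have h4 : ((-1 : ℂ) ^ (n + 1)) * (-1) ^ (n + 1) = 1 := by
      rw [← pow_add, Even.neg_one_pow]; exact ⟨n + 1, by ring⟩
    calc X k = ψ * (-1) ^ (n + 1 + 1) * t * (a * X k) := by rw [← mul_assoc, h2, one_mul]
      _ = _ := by
        rw [← h1, pow_add (-1 : ℂ) (n + 1) (k : ℕ), pow_succ (-1 : ℂ) (n + 1), pow_succ (-1 : ℂ) (k : ℕ)]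
        linear_combination (-ψ * t * (-1) ^ (k : ℕ) * lastRowMinor (W₀ * T) k) * h4

end LinearAlgebra
end BetheLeonard

/-! ### The dynamical operators as linear polynomials in Z -/

namespace BetheLeonard
open Params Polynomial
variable {P : Params} {V : Type*} [AddCommGroup V] [Module ℂ V] {A As : Module.End ℂ V}
  {v w : Module.Basis (Fin (P.d + 1)) ℂ V}

namespace Params
variable (P)

/-- The scalar weight of one operator `𝓑^ε(u, m + 2j)` that does not depend on `u`. -/
noncomputable def cst (ε : ℤˣ) (j : ℤ) : ℂ :=
  (if ε = 1 then P.cs * P.q ^ (-(2 * j) - 2) else -P.b * P.q ^ (2 * j + 2)) *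
    (P.q ^ 2 - P.q⁻¹ ^ 2) ^ 2 / (P.ρ * P.r0 ^ 2)

/-- The scalar weight of one operator `𝓑^ε(u, m)` that depends on `u`. -/
noncomputable def wt (ε : ℤˣ) (u : ℂ) : ℂ := bfun (u ^ 2) / u ^ (ε : ℤ)

/-- `∏ᵢ (X - z(uᵢ²))`. -/
noncomputable def nodePoly {n : ℕ} (u : Fin n → ℂ) : ℂ[X] := ∏ i, (X - C (P.z (u i ^ 2)))

variable {P}

lemma Admissible.ρ_ne_zero (hP : P.Admissible) : P.ρ ≠ 0 := by
  have h := hP.ρ_eq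
  intro h0
  rw [h0, mul_zero, eq_comm, neg_eq_zero] at h
  exact hP.sq_sub_inv_sq_ne_zero (pow_eq_zero_iff two_ne_zero |>.1 h)

lemma Admissible.cst_ne_zero (hP : P.Admissible) (ε : ℤˣ) (j : ℤ) : P.cst ε j ≠ 0 := by
  have hq := hP.q_ne_zero
  have h1 := hP.ρ_ne_zero
  have h2 := hP.sq_sub_inv_sq_ne_zero
  have h3 := hP.r0_ne_zero
  have h4 := hP.cs_ne_zero
  have h5 := hP.b_ne_zero
  unfold cst
  split_ifs
  · positivity
  · exact div_ne_zero (mul_ne_zero (mul_ne_zero (neg_ne_zero.2 h5) (zpow_ne_zero _ hq))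
      (pow_ne_zero 2 h2)) (mul_ne_zero h1 (pow_ne_zero 2 h3))

end Params

lemma qComm_eq_Z (hP : P.Admissible) : qComm P.q As A =
    ((P.q ^ 2 - P.q⁻¹ ^ 2) / P.r0 ^ 2) • P.Z A As - (P.ω / (P.q - P.q⁻¹)) • (1 : Module.End ℂ V) := by
  have h2 := hP.sq_sub_inv_sq_ne_zero
  have h3 := hP.r0_ne_zero
  unfold Z
  rw [smul_smul, div_mul_div_cancel₀ (pow_ne_zero 2 h3), div_self h2, one_smul, add_sub_cancel_right]

lemma dynBplus_eq (hP : P.Admissible) {α χ : ℂ} (hχ : χ ≠ 0) {m : ℤ}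
    (hg : GaugeCondition P 1 α χ m) {u : ℂ} (hu : u ≠ 0) (j : ℤ) :
    dynBplus P A As α 0 χ u (m + 2 * j) =
      (P.cst 1 j * wt 1 u) • (P.Z A As - P.z (u ^ 2) • (1 : Module.End ℂ V)) := by
  have hq := hP.q_ne_zero
  have h1 := hP.sub_inv_ne_zero
  have h2 := hP.add_inv_ne_zero
  have h3 := hP.sq_sub_inv_sq_ne_zero
  have h4 := hP.r0_ne_zero
  have h5 := hP.cs_ne_zero
  have hb2 : bfun (P.q ^ 2) = P.q ^ 2 - P.q⁻¹ ^ 2 := by unfold bfun; rw [inv_pow]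
  have hf : P.q ^ 2 - P.q⁻¹ ^ 2 = (P.q - P.q⁻¹) * (P.q + P.q⁻¹) := by ring
  have hq2 : P.q ^ 2 + 1 = P.q * (P.q + P.q⁻¹) := by field_simp
  have hρ' : P.ρ = -(P.q ^ 2 - P.q⁻¹ ^ 2) ^ 2 / P.r0 ^ 2 := by rw [← hP.ρ_eq]; field_simp
  have hG : P.q ^ m ≠ 0 := zpow_ne_zero _ hq
  have hJ : P.q ^ (2 * j) ≠ 0 := zpow_ne_zero _ hq
  unfold GaugeCondition at hg
  rw [if_pos rfl, zpow_neg, show P.q ^ (2 : ℤ) = P.q ^ 2 by norm_cast, ← inv_pow] at hg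
  -- The gauge condition makes α proportional to χ, so χ cancels, and with it every power of q^m.
  have hα : α = χ / ((P.q ^ 2 - P.q⁻¹ ^ 2) * P.cs * P.q ^ m) := by
    generalize P.q ^ 2 - P.q⁻¹ ^ 2 = n at *
    field_simp at hg ⊢
    linear_combination hg
  have e1 : P.q ^ (m + 2 * j) = P.q ^ m * P.q ^ (2 * j) := zpow_add₀ hq _ _
  have e2 : P.q ^ (2 * (m + 2 * j) + 2) = (P.q ^ m * P.q ^ (2 * j)) ^ 2 * P.q ^ 2 := by
    rw [zpow_add₀ hq, mul_comm 2 (m + 2 * j), zpow_mul, e1]; norm_cast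
  have e2' : P.q ^ (2 * (m + 2 * j)) = (P.q ^ m * P.q ^ (2 * j)) ^ 2 := by
    rw [mul_comm 2 (m + 2 * j), zpow_mul, e1]; norm_cast
  have e3 : P.q ^ (-(m + 2 * j) - 3) = (P.q ^ m * P.q ^ (2 * j))⁻¹ * (P.q ^ 3)⁻¹ := by
    rw [sub_eq_add_neg, zpow_add₀ hq, zpow_neg, zpow_neg, e1]; norm_cast
  have e4 : P.q ^ (-(2 * j) - 2) = (P.q ^ (2 * j))⁻¹ * (P.q ^ 2)⁻¹ := by
    rw [sub_eq_add_neg, zpow_add₀ hq, zpow_neg, zpow_neg]; norm_cast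
  have e5 : u ^ (-3 : ℤ) = (u ^ 3)⁻¹ := by rw [zpow_neg]; norm_cast
  unfold dynBplus Params.cst wt
  rw [if_pos rfl, qComm_eq_Z hP, e1, e2, e2', e3, e4, e5, hα, hb2]
  simp only [ne_eq, OfNat.ofNat_ne_zero, not_false_eq_true, zero_pow, zero_mul, zero_div, zero_smul,
    sub_zero, add_zero, zero_sub]
  unfold z
  generalize P.q ^ m = G at *
  generalize P.q ^ (2 * j) = J at *
  generalize bfun (u ^ 2) = β at *
  rw [hρ', hq2, hf]
  generalize hm : P.q - P.q⁻¹ = m' at *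
  generalize hn : P.q + P.q⁻¹ = n at *
  match_scalars <;> simp <;> field_simp
  ring

lemma dynBminus_eq (hP : P.Admissible) {α χ : ℂ} (hχ : χ ≠ 0) {m : ℤ}
    (hg : GaugeCondition P (-1) α χ m) {u : ℂ} (hu : u ≠ 0) (j : ℤ) :
    dynBminus P A As α 0 χ u (m + 2 * j) =
      (P.cst (-1) j * wt (-1) u) • (P.Z A As - P.z (u ^ 2) • (1 : Module.End ℂ V)) := by
  have hq := hP.q_ne_zero
  have h1 := hP.sub_inv_ne_zero
  have h2 := hP.add_inv_ne_zero
  have h3 := hP.sq_sub_inv_sq_ne_zero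
  have h4 := hP.r0_ne_zero
  have h5 := hP.b_ne_zero
  have hb2 : bfun (P.q ^ 2) = P.q ^ 2 - P.q⁻¹ ^ 2 := by unfold bfun; rw [inv_pow]
  have hf : P.q ^ 2 - P.q⁻¹ ^ 2 = (P.q - P.q⁻¹) * (P.q + P.q⁻¹) := by ring
  have hq2 : P.q ^ 2 + 1 = P.q * (P.q + P.q⁻¹) := by field_simp
  have hρ' : P.ρ = -(P.q ^ 2 - P.q⁻¹ ^ 2) ^ 2 / P.r0 ^ 2 := by rw [← hP.ρ_eq]; field_simp
  have hG : P.q ^ m ≠ 0 := zpow_ne_zero _ hq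
  have hJ : P.q ^ (2 * j) ≠ 0 := zpow_ne_zero _ hq
  have hε : (-1 : ℤˣ) ≠ 1 := by decide
  unfold GaugeCondition at hg
  rw [if_neg hε, zpow_neg, zpow_neg, show P.q ^ (2 : ℤ) = P.q ^ 2 by norm_cast, ← inv_pow] at hg
  have hα : α = -(χ * P.q ^ m) / ((P.q ^ 2 - P.q⁻¹ ^ 2) * P.b) := by
    generalize P.q ^ 2 - P.q⁻¹ ^ 2 = n at *
    field_simp at hg ⊢
    linear_combination hg
  have e1 : P.q ^ (m + 2 * j) = P.q ^ m * P.q ^ (2 * j) := zpow_add₀ hq _ _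
  have e2 : P.q ^ (2 * (m + 2 * j) + 1) = (P.q ^ m * P.q ^ (2 * j)) ^ 2 * P.q := by
    rw [zpow_add_one₀ hq, mul_comm 2 (m + 2 * j), zpow_mul, e1]; norm_cast
  have e3 : P.q ^ (-(m + 2 * j) - 1) = (P.q ^ m * P.q ^ (2 * j))⁻¹ * P.q⁻¹ := by
    rw [zpow_sub_one₀ hq, zpow_neg, e1]
  have e3' : P.q ^ (-(m + 2 * j) - 4) = (P.q ^ m * P.q ^ (2 * j))⁻¹ * (P.q ^ 4)⁻¹ := by
    rw [sub_eq_add_neg, zpow_add₀ hq, zpow_neg, zpow_neg, e1]; norm_cast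
  have e4 : P.q ^ (2 * j + 2) = P.q ^ (2 * j) * P.q ^ 2 := by
    rw [zpow_add₀ hq]; norm_cast
  have e5 : P.q ^ (-2 : ℤ) = (P.q ^ 2)⁻¹ := by rw [zpow_neg]; norm_cast
  unfold dynBminus Params.cst wt
  rw [if_neg hε, qComm_eq_Z hP, e2, e3, e3', e4, e5, hα, hb2]
  simp only [ne_eq, OfNat.ofNat_ne_zero, not_false_eq_true, zero_pow, zero_mul, zero_div, zero_smul,
    sub_zero, add_zero, zero_sub]
  unfold z
  generalize P.q ^ m = G at *
  generalize P.q ^ (2 * j) = J at *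
  generalize bfun (u ^ 2) = β at *
  rw [hρ', hq2, hf]
  generalize hm : P.q - P.q⁻¹ = m' at *
  generalize hn : P.q + P.q⁻¹ = n at *
  match_scalars <;> simp <;> field_simp
  ring

lemma dynB_eq (hP : P.Admissible) (ε : ℤˣ) {α χ : ℂ} (hχ : χ ≠ 0) {m : ℤ}
    (hg : GaugeCondition P ε α χ m) {u : ℂ} (hu : u ≠ 0) (j : ℤ) :
    dynB P A As ε α 0 χ u (m + 2 * j) =
      aeval (P.Z A As) (C (P.cst ε j * wt ε u) * (X - C (P.z (u ^ 2)))) := by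
  rw [map_mul, map_sub, aeval_C, aeval_C, aeval_X, Algebra.algebraMap_eq_smul_one,
    Algebra.algebraMap_eq_smul_one, smul_mul_assoc, one_mul]
  unfold dynB
  rcases Int.units_eq_one_or ε with rfl | rfl
  · rw [if_pos rfl]; exact dynBplus_eq hP hχ hg hu j
  · rw [if_neg (by decide)]; exact dynBminus_eq hP hχ hg hu j

end BetheLeonard

/-! ### Bethe states, and the coefficients written through Λ₁, Λ₂, η and η* -/

namespace BetheLeonard
open Params Polynomial
variable {P : Params} {V : Type*} [AddCommGroup V] [Module ℂ V] {A As : Module.End ℂ V}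
  {v w : Module.Basis (Fin (P.d + 1)) ℂ V}

lemma betheState_eq (hP : P.Admissible) (ε : ℤˣ) {α χ : ℂ} (hχ : χ ≠ 0) {m : ℤ}
    (hg : GaugeCondition P ε α χ m) {n : ℕ} {u : Fin n → ℂ} (hu : ∀ i, u i ≠ 0) :
    betheState P A As v w ε α χ m u =
      ((∏ i : Fin n, P.cst ε ((n : ℤ) - 1 - (i : ℕ))) * ∏ i, wt ε (u i)) •
        aeval (P.Z A As) (P.nodePoly u) (refState P v w ε) := by
  unfold betheState stringB
  have h : ∀ i : Fin n, dynB P A As ε α 0 χ (u i) (m + 2 * ((n : ℤ) - 1 - ((i : ℕ) : ℤ))) =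
      aeval (P.Z A As) (C (P.cst ε ((n : ℤ) - 1 - (i : ℕ)) * wt ε (u i)) * (X - C (P.z (u i ^ 2)))) :=
    fun i => dynB_eq hP ε hχ hg (hu i) _
  simp only [h]
  have h2 : (List.ofFn fun i : Fin n => aeval (P.Z A As)
      (C (P.cst ε ((n : ℤ) - 1 - (i : ℕ)) * wt ε (u i)) * (X - C (P.z (u i ^ 2))))) =
      (List.ofFn fun i : Fin n => C (P.cst ε ((n : ℤ) - 1 - (i : ℕ)) * wt ε (u i)) *
        (X - C (P.z (u i ^ 2)))).map (aeval (P.Z A As)) := by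
    rw [List.map_ofFn]; rfl
  rw [h2, ← map_list_prod, List.prod_ofFn, Finset.prod_mul_distrib, ← nodePoly, ← map_prod,
    Finset.prod_mul_distrib, map_mul, aeval_C, Module.End.mul_apply, Module.algebraMap_end_apply]

namespace Params

/-- The last two factors of Λ₁ multiply out to the four-term factor of f₁ because bc = b*c*; the
ζ-factors give the one containing H. -/
lemma f₁_eq (hP : P.Admissible) (ε : ℤˣ) {u : ℂ} (hu : u ≠ 0) :
    P.f₁ ε (u ^ 2) = u ^ (2 * (ε : ℤ) + 1) * Λ₁ P ε u / (bfun (u ^ 2) * bfun (P.q * u ^ 2)) := by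
  have hq := hP.q_ne_zero
  have hT := hP.T_ne_zero
  have hz := hP.ζ_ne_zero
  have hb := hP.b_ne_zero
  have hcs := hP.cs_ne_zero
  have e1 : P.q ^ (-(P.d : ℤ)) = P.T⁻¹ := by rw [zpow_neg]; rfl
  have e2 : P.q ^ (-(P.d : ℤ) - 1) = P.T⁻¹ * P.q⁻¹ := by rw [zpow_sub_one₀ hq, e1]
  have e3 : P.q ^ ((P.d : ℤ) + 1) = P.T * P.q := by rw [zpow_add_one₀ hq]; rfl
  have e4 : P.q ^ (P.d : ℤ) = P.T := rfl
  unfold Params.f₁ Λ₁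
  rw [e1, e2, e3, e4]
  rcases Int.units_eq_one_or ε with rfl | rfl
  · have hc : P.c = P.bs * P.cs / P.b := by rw [hP.bscs_eq, ← hP.bc_eq]; field_simp
    rw [if_pos rfl]
    unfold rf1p
    congr 1
    norm_num
    rw [hc, H]
    field_simp
    ring
  · have hc : P.bs = P.b * P.c / P.cs := by rw [hP.bc_eq, ← hP.bscs_eq]; field_simp
    rw [if_neg (by decide)]
    unfold rf1m
    congr 1
    norm_num
    rw [hc, H]
    field_simp
    ring

lemma f₂_eq (hP : P.Admissible) (ε : ℤˣ) {u : ℂ} (hu : P.Regular u) :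
    P.f₂ ε (u ^ 2) = P.q ^ (-(ε : ℤ) - 1) * u⁻¹ * Λ₂ P ε u /
      (bfun (u ^ 2) * bfun (P.q ^ 2 * u ^ 2)) := by
  have hq := hP.q_ne_zero
  have hT := hP.T_ne_zero
  have hz := hP.ζ_ne_zero
  have hb := hP.b_ne_zero
  have hcs := hP.cs_ne_zero
  have hu0 := hu.ne_zero
  have h1 := hu.b_sq
  have h2 := hu.b_q_sq
  have e1 : P.q ^ (-(P.d : ℤ)) = P.T⁻¹ := by rw [zpow_neg]; rfl
  have e2 : P.q ^ (-(P.d : ℤ) - 1) = P.T⁻¹ * P.q⁻¹ := by rw [zpow_sub_one₀ hq, e1]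
  have e3 : P.q ^ ((P.d : ℤ) - 1) = P.T * P.q⁻¹ := by rw [zpow_sub_one₀ hq]; rfl
  have e4 : P.q ^ (P.d : ℤ) = P.T := rfl
  have e5 : u ^ 2 - u ^ (-2 : ℤ) = bfun (u ^ 2) := by unfold bfun; rw [zpow_neg]; norm_cast
  have e6 : P.q * u ^ 2 - P.q⁻¹ * u ^ (-2 : ℤ) = bfun (P.q * u ^ 2) := by
    unfold bfun; rw [zpow_neg, mul_inv]; norm_cast
  unfold Params.f₂ Λ₂
  rw [e1, e2, e3, e4, e5, e6]
  rw [mul_comm (bfun (u ^ 2)) (bfun (P.q ^ 2 * u ^ 2)), ← div_div]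
  rcases Int.units_eq_one_or ε with rfl | rfl
  · have hc : P.c = P.bs * P.cs / P.b := by rw [hP.bscs_eq, ← hP.bc_eq]; field_simp
    rw [if_pos rfl]
    unfold rf2p
    norm_num
    rw [hc, H]
    generalize bfun (u ^ 2) = β₁ at *
    generalize bfun (P.q * u ^ 2) = β₂ at *
    generalize bfun (P.q ^ 2 * u ^ 2) = β₃ at *
    field_simp
    ring
  · have hc : P.bs = P.b * P.c / P.cs := by rw [hP.bc_eq, ← hP.bscs_eq]; field_simp
    rw [if_neg (by decide)]
    unfold rf2m
    norm_num
    rw [hc, H]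
    generalize bfun (u ^ 2) = β₁ at *
    generalize bfun (P.q * u ^ 2) = β₂ at *
    generalize bfun (P.q ^ 2 * u ^ 2) = β₃ at *
    field_simp
    ring

lemma f₀_eq_diag (hP : P.Admissible) {u : ℂ} (hu : P.Regular u) :
    P.f₀ (u ^ 2) = (P.q + P.q⁻¹) ^ 2 / (P.ρ * bfun (u ^ 2) * bfun (P.q ^ 2 * u ^ 2)) *
      (P.ηs + P.η * ((P.q * u ^ 2 + P.q⁻¹ * u ^ (-2 : ℤ)) / (P.q + P.q⁻¹))) := by
  have hq := hP.q_ne_zero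
  have h1 := hP.sub_inv_ne_zero
  have h2 := hP.add_inv_ne_zero
  have h4 := hP.r0_ne_zero
  have h5 := hu.b_sq
  have h6 := hu.b_q2_sq
  have hf : P.q ^ 2 - P.q⁻¹ ^ 2 = (P.q - P.q⁻¹) * (P.q + P.q⁻¹) := by ring
  have hρ' : P.ρ = -(P.q ^ 2 - P.q⁻¹ ^ 2) ^ 2 / P.r0 ^ 2 := by rw [← hP.ρ_eq]; field_simp
  have e : P.q * u ^ 2 + P.q⁻¹ * u ^ (-2 : ℤ) = P.q * u ^ 2 + (P.q * u ^ 2)⁻¹ := by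
    rw [zpow_neg, mul_inv]; norm_cast
  rw [e, hρ', hP.η_eq, hP.ηs_eq, hf]
  unfold f₀ rf0 reta
  generalize bfun (u ^ 2) = β₁ at *
  generalize bfun (P.q ^ 2 * u ^ 2) = β₃ at *
  generalize P.q * u ^ 2 + (P.q * u ^ 2)⁻¹ = z at *
  generalize P.q - P.q⁻¹ = m at *
  generalize P.q + P.q⁻¹ = n at *
  generalize P.q * P.T + (P.q * P.T)⁻¹ = N at *
  generalize P.b * P.T + P.c / P.T = t at *
  generalize P.bs * P.T + P.cs / P.T = ts at *
  field_simp
  ring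

end Params
end BetheLeonard

/-! ### Interpolation and the kernel of the linear system -/

namespace BetheLeonard
open Params Polynomial
variable {P : Params} {V : Type*} [AddCommGroup V] [Module ℂ V] {A As : Module.End ℂ V}
  {v w : Module.Basis (Fin (P.d + 1)) ℂ V}

namespace Params

lemma z_sub (hq : P.q ≠ 0) {u t : ℂ} (hu : u ≠ 0) (ht : t ≠ 0) :
    P.z (u ^ 2) - P.z (t ^ 2) = bfun (u / t) * bfun (P.q * u * t) := by
  unfold z bfun; field_simp; ring

lemma z_down_sub (hq : P.q ≠ 0) {u t : ℂ} (hu : u ≠ 0) (ht : t ≠ 0) :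
    P.z (u ^ 2 / P.q ^ 2) - P.z (t ^ 2) = bfun (u / (P.q * t)) * bfun (u * t) := by
  unfold z bfun; field_simp; ring

lemma z_up_sub (hq : P.q ≠ 0) {u t : ℂ} (hu : u ≠ 0) (ht : t ≠ 0) :
    P.z (P.q ^ 2 * u ^ 2) - P.z (t ^ 2) = bfun (P.q * u / t) * bfun (P.q ^ 2 * u * t) := by
  unfold z bfun; field_simp; ring

lemma nodePoly_monic {n : ℕ} (u : Fin n → ℂ) : (P.nodePoly u).Monic := monic_prod_X_sub_C _ _

lemma natDegree_nodePoly {n : ℕ} (u : Fin n → ℂ) : (P.nodePoly u).natDegree = n := by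
  unfold nodePoly; rw [natDegree_finsetProd_X_sub_C_eq_card, Finset.card_univ, Fintype.card_fin]

lemma eval_nodePoly {n : ℕ} (u : Fin n → ℂ) (x : ℂ) :
    (P.nodePoly u).eval x = ∏ i, (x - P.z (u i ^ 2)) := by
  simp [nodePoly, eval_prod]

variable (P) in
/-- The polynomial of degree at most `2s` that represents `act f` modulo `gridPoly`. -/
noncomputable def actTrunc (ε : ℤˣ) (f : ℂ[X]) : ℂ[X] :=
  P.act ε f - C (P.ν ε * P.q⁻¹ ^ (2 * P.d)) * P.gridPoly

/-- The subtracted multiple of `gridPoly` is chosen to cancel the coefficient of degree 2s+1 found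
in `coeff_awAct`. -/
lemma degree_actTrunc_lt (hP : P.Admissible) (ε : ℤˣ) {f : ℂ[X]} (hf : f.Monic)
    (hd : f.natDegree = P.d) : (P.actTrunc ε f).degree < (P.d + 1 : ℕ) := by
  rw [degree_lt_iff_coeff_zero]
  intro m hm
  unfold actTrunc
  rw [coeff_sub, coeff_C_mul]
  rcases Nat.eq_or_lt_of_le hm with rfl | hm
  · have h1 : P.gridPoly.coeff (P.d + 1) = 1 := by
      rw [← natDegree_gridPoly]; exact gridPoly_monic.coeff_natDegree
    have h2 : f.coeff P.d = 1 := by rw [← hd]; exact hf.coeff_natDegree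
    rw [h1, act, coeff_awAct hP.q_ne_zero hd.le, h2]
    ring
  · rw [coeff_eq_zero_of_natDegree_lt (p := P.gridPoly) (by rw [natDegree_gridPoly]; exact hm),
      act, coeff_eq_zero_of_natDegree_lt ((natDegree_awAct_le hd.le).trans_lt hm)]
    ring

end Params

namespace Generic
variable {y : Fin (P.d + 1) → ℂ} (hy : Generic P y)
include hy

lemma regular (i : Fin (P.d + 1)) : P.Regular (y i) :=
  ⟨hy.ne_zero i, hy.b_sq i, hy.b_q_sq i, hy.b_q2_sq i⟩

lemma z_ne (hq : P.q ≠ 0) {i j : Fin (P.d + 1)} (h : i ≠ j) : P.z (y i ^ 2) - P.z (y j ^ 2) ≠ 0 := by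
  rw [z_sub hq (hy.ne_zero i) (hy.ne_zero j)]
  exact mul_ne_zero (hy.b_div i j h) (hy.b_mul i j h)

omit hy in
lemma eval_node_ne {j k : Fin (P.d + 1)} (h : k ≠ j) :
    (P.nodePoly (drop y j)).eval (P.z (y k ^ 2)) = 0 := by
  obtain ⟨i, rfl⟩ := Fin.exists_succAbove_eq h
  rw [eval_nodePoly]
  exact Finset.prod_eq_zero (Finset.mem_univ i) (by simp [drop])

lemma gfun_mul_eval (hq : P.q ≠ 0) (k : Fin (P.d + 1)) :
    gfun P (y k) (drop y k) * (P.nodePoly (drop y k)).eval (P.z (y k ^ 2)) = 1 := by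
  rw [eval_nodePoly, gfun, ← Finset.prod_mul_distrib]
  refine Finset.prod_eq_one fun i _ => ?_
  unfold drop
  rw [z_sub hq (hy.ne_zero k) (hy.ne_zero _)]
  have h : k ≠ k.succAbove i := (Fin.succAbove_ne k i).symm
  exact inv_mul_cancel₀ (mul_ne_zero (hy.b_div _ _ h) (hy.b_mul _ _ h))

/-- Lagrange interpolation at the points `z(y_k²)`. -/
lemma interpolation (hq : P.q ≠ 0) {f : ℂ[X]} (hf : f.degree < (P.d + 1 : ℕ)) :
    f = ∑ k, C (f.eval (P.z (y k ^ 2)) * gfun P (y k) (drop y k)) * P.nodePoly (drop y k) := by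
  have hcard : (Finset.univ : Finset (Fin (P.d + 1))).card = P.d + 1 := by simp
  refine eq_of_degrees_lt_of_eval_index_eq (v := fun k => P.z (y k ^ 2)) Finset.univ ?_ ?_ ?_ ?_
  · intro i _ j _ hij
    by_contra hne
    exact hy.z_ne hq hne (sub_eq_zero.2 hij)
  · rw [hcard]; exact hf
  · rw [hcard]
    refine (degree_sum_le _ _).trans_lt ((Finset.sup_lt_iff (WithBot.bot_lt_coe _)).2 fun k _ => ?_)
    rw [← smul_eq_C_mul]
    refine lt_of_le_of_lt (degree_smul_le _ _) ?_
    rw [degree_eq_natDegree (nodePoly_monic _).ne_zero, natDegree_nodePoly]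
    exact_mod_cast Nat.lt_succ_self _
  · intro l _
    rw [eval_finsetSum, Finset.sum_eq_single l]
    · rw [eval_mul, eval_C, mul_assoc, hy.gfun_mul_eval hq, mul_one]
    · intro k _ hk
      rw [eval_mul, eval_node_ne hk.symm, mul_zero]
    · simp

lemma wt_ne_zero (ε : ℤˣ) (k : Fin (P.d + 1)) : wt ε (y k) ≠ 0 :=
  div_ne_zero (hy.b_sq k) (zpow_ne_zero _ (hy.ne_zero k))

lemma eval_actTrunc (hP : P.Admissible) (ε : ℤˣ) (j k : Fin (P.d + 1)) :
    (P.actTrunc ε (P.nodePoly (drop y j))).eval (P.z (y k ^ 2)) =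
      Yfun P ε (y k) (drop y j) +
        P.f₀ (y k ^ 2) * (P.nodePoly (drop y j)).eval (P.z (y k ^ 2)) := by
  have hq := hP.q_ne_zero
  have hu := hy.regular k
  have hdrop : ∀ i, drop y j i ≠ 0 := fun i => hy.ne_zero _
  have hν : P.ν ε * P.q⁻¹ ^ (2 * P.d) = (if ε = 1 then 1 else 0) * νplus P := by
    unfold Params.ν νplus
    split_ifs
    · rw [zpow_sub₀ hq, zpow_neg_one, inv_pow, show P.q ^ (2 * (P.d : ℤ)) = P.q ^ (2 * P.d) by norm_cast]
      ring
    · ring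
  unfold actTrunc
  rw [eval_sub, eval_mul, eval_C, hν, hP.gridPoly_eval hu.ne_zero, eval_act hP ε _ hu,
    f₁_eq hP ε hu.ne_zero, f₂_eq hP ε hu, eval_nodePoly _ (P.z (y k ^ 2 / P.q ^ 2)),
    eval_nodePoly _ (P.z (P.q ^ 2 * y k ^ 2)),
    Finset.prod_congr rfl fun i _ => z_down_sub hq hu.ne_zero (hdrop i),
    Finset.prod_congr rfl fun i _ => z_up_sub hq hu.ne_zero (hdrop i)]
  unfold Yfun hp
  ring

/-- Off the diagonal the f₀ term drops out because the node polynomial vanishes at z(y_k²); on it,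
`gfun` normalises that polynomial to 1. -/
lemma Lmat_eq (hP : P.Admissible) (ε : ℤˣ) (j k : Fin (P.d + 1)) :
    Lmat P ε y j k = wt ε (y k) / wt ε (y j) *
      ((P.actTrunc ε (P.nodePoly (drop y j))).eval (P.z (y k ^ 2)) * gfun P (y k) (drop y k)) := by
  have hw : wt ε (y k) / wt ε (y j) =
      (y j / y k) ^ (ε : ℤ) * (bfun (y k ^ 2) / bfun (y j ^ 2)) := by
    unfold wt
    rw [div_zpow, div_div_div_eq, mul_comm (bfun (y k ^ 2)), mul_div_mul_comm]
  rw [hy.eval_actTrunc hP, hw, Lmat, Matrix.of_apply]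
  by_cases hjk : j = k
  · subst hjk
    have h1 := hy.gfun_mul_eval hP.q_ne_zero j
    rw [if_pos rfl, mul_one, ← f₀_eq_diag hP (hy.regular j), ← hw,
      div_self (hy.wt_ne_zero ε j)]
    linear_combination (-P.f₀ (y j ^ 2)) * h1
  · rw [if_neg hjk, eval_node_ne (Ne.symm hjk)]
    ring

end Generic

/-- The Bethe vector on `y` without its `k`-th member, up to a scalar independent of `y`. -/
noncomputable def betheVec (P : Params) (A As : Module.End ℂ V)
    (v w : Module.Basis (Fin (P.d + 1)) ℂ V) (ε : ℤˣ) (y : Fin (P.d + 1) → ℂ)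
    (k : Fin (P.d + 1)) : V :=
  (∏ i, wt ε (drop y k i)) • aeval (P.Z A As) (P.nodePoly (drop y k)) (refState P v w ε)

namespace IsLeonardPair
variable (hA : IsLeonardPair P A As v w) (hP : P.Admissible)
  {y : Fin (P.d + 1) → ℂ} (hy : Generic P y)
include hA hP hy

omit hy in
lemma aeval_actTrunc (ε : ℤˣ) (f : ℂ[X]) :
    A (aeval (P.Z A As) f (refState P v w ε)) =
      aeval (P.Z A As) (P.actTrunc ε f) (refState P v w ε) := by
  rw [hA.apply_aeval hP, actTrunc, map_sub, map_mul, hA.aeval_gridPoly hP, mul_zero, sub_zero]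

lemma apply_betheVec (ε : ℤˣ) (j : Fin (P.d + 1)) :
    A (betheVec P A As v w ε y j) = ∑ k, Lmat P ε y j k • betheVec P A As v w ε y k := by
  have hint := hy.interpolation hP.q_ne_zero
    (degree_actTrunc_lt hP ε (nodePoly_monic (P := P) (drop y j)) (natDegree_nodePoly _))
  have hprod : ∀ k, wt ε (y k) * ∏ i, wt ε (drop y k i) = ∏ i, wt ε (y i) :=
    fun k => (Fin.prod_univ_succAbove (fun i => wt ε (y i)) k).symm
  unfold betheVec
  rw [map_smul, hA.aeval_actTrunc hP ε, hint, map_sum, LinearMap.sum_apply, Finset.smul_sum]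
  refine Finset.sum_congr rfl fun k _ => ?_
  rw [map_mul, aeval_C, Module.End.mul_apply, Module.algebraMap_end_apply, smul_smul, smul_smul,
    hy.Lmat_eq hP]
  congr 1
  have hj := hy.wt_ne_zero ε j
  have h : ∏ i, wt ε (drop y j i) = wt ε (y k) / wt ε (y j) * ∏ i, wt ε (drop y k i) := by
    rw [div_mul_eq_mul_div, eq_div_iff hj, mul_comm, hprod, hprod]
  rw [h]
  ring

/-- By cyclicity and reduction modulo `gridPoly`, every vector comes from a polynomial of degree at
most 2s, which interpolation expands in the node polynomials. -/
lemma betheVec_span (ε : ℤˣ) : ⊤ ≤ Submodule.span ℂ (Set.range (betheVec P A As v w ε y)) := by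
  intro x _
  obtain ⟨f, rfl⟩ := hA.cyclic hP ε x
  have hmod : aeval (P.Z A As) f = aeval (P.Z A As) (f %ₘ P.gridPoly) := by
    conv_lhs => rw [← modByMonic_add_div f P.gridPoly]
    rw [map_add, map_mul, hA.aeval_gridPoly hP, zero_mul, add_zero]
  have hdeg : (f %ₘ P.gridPoly).degree < (P.d + 1 : ℕ) := by
    have := degree_modByMonic_lt f (gridPoly_monic (P := P))
    rwa [degree_eq_natDegree gridPoly_monic.ne_zero, natDegree_gridPoly] at this
  rw [hmod, hy.interpolation hP.q_ne_zero hdeg, map_sum, LinearMap.sum_apply]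
  refine Submodule.sum_mem _ fun k _ => ?_
  rw [map_mul, aeval_C, Module.End.mul_apply, Module.algebraMap_end_apply]
  refine Submodule.smul_mem _ _ ?_
  have hw : ∏ i, wt ε (drop y k i) ≠ 0 := Finset.prod_ne_zero_iff.2 fun i _ => hy.wt_ne_zero ε _
  exact (Submodule.smul_mem_iff _ hw).1 (Submodule.subset_span ⟨k, rfl⟩)

/-- The Bethe vectors form a basis. -/
lemma exists_basis_betheVec (ε : ℤˣ) : ∃ e : Module.Basis (Fin (P.d + 1)) ℂ V,
    ∀ k, e k = betheVec P A As v w ε y k := by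
  refine ⟨basisOfTopLeSpanOfCardEqFinrank _ (hA.betheVec_span hP hy ε)
    (Module.finrank_eq_card_basis v).symm, fun k => by simp⟩

variable {bra : Fin (P.d + 1) → Module.Dual ℂ V}

omit hP hy in
lemma dual_eq_zero_of_ne {M i : Fin (P.d + 1)} {g : Module.Dual ℂ V}
    (hg : g ∘ₗ A = P.θ M • g) (h : i ≠ M) : g (v i) = 0 := by
  have h1 := LinearMap.congr_fun hg (v i)
  rw [LinearMap.comp_apply, hA.eigenbasis.eigen, map_smul, LinearMap.smul_apply, smul_eq_mul,
    smul_eq_mul] at h1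
  by_contra hne
  exact h (hA.eigenbasis.distinct (mul_right_cancel₀ hne h1))

omit hP hy in
lemma dual_apply_ne_zero {M : Fin (P.d + 1)} {g : Module.Dual ℂ V} (hg0 : g ≠ 0)
    (hg : g ∘ₗ A = P.θ M • g) : g (v M) ≠ 0 := by
  intro h
  apply hg0
  refine v.ext fun i => ?_
  by_cases hi : i = M
  · rw [hi, h, LinearMap.zero_apply]
  · rw [hA.dual_eq_zero_of_ne hg hi, LinearMap.zero_apply]

omit hP hy in
lemma dual_eq_smul {M : Fin (P.d + 1)} {g g' : Module.Dual ℂ V} (hg0 : g ≠ 0)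
    (hg : g ∘ₗ A = P.θ M • g) (hg' : g' ∘ₗ A = P.θ M • g') :
    g' = (g' (v M) / g (v M)) • g := by
  have h0 := hA.dual_apply_ne_zero hg0 hg
  refine v.ext fun i => ?_
  rw [LinearMap.smul_apply, smul_eq_mul]
  by_cases hi : i = M
  · rw [hi]; field_simp
  · rw [hA.dual_eq_zero_of_ne hg hi, hA.dual_eq_zero_of_ne hg' hi, mul_zero]

open Matrix in
/-- The kernel of `𝓜^{ε,M}` is spanned by the components of `⟨θ_M|` on the Bethe vectors. -/
lemma kernel_BSmat (ε : ℤˣ) {M : Fin (P.d + 1)} {g : Module.Dual ℂ V} (hg0 : g ≠ 0)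
    (hg : g ∘ₗ A = P.θ M • g) :
    (fun k => g (betheVec P A As v w ε y k)) ≠ 0 ∧
    (BSmat P ε M y *ᵥ fun k => g (betheVec P A As v w ε y k)) = 0 ∧
    ∀ Y, BSmat P ε M y *ᵥ Y = 0 → ∃ a : ℂ, Y = a • fun k => g (betheVec P A As v w ε y k) := by
  obtain ⟨e, he⟩ := hA.exists_basis_betheVec hP hy ε
  have hmul : ∀ Y : Fin (P.d + 1) → ℂ, ∀ j, (BSmat P ε M y *ᵥ Y) j =
      ∑ k, Lmat P ε y j k * Y k - P.θ M * Y j := by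
    intro Y j
    rw [BSmat, sub_mulVec, smul_mulVec, one_mulVec]
    rfl
  refine ⟨fun h => hg0 (e.ext fun k => ?_), ?_, fun Y hY => ?_⟩
  · rw [he]; exact congrFun h k
  · ext j
    rw [hmul]
    have h1 := LinearMap.congr_fun hg (betheVec P A As v w ε y j)
    rw [LinearMap.comp_apply, hA.apply_betheVec hP hy, map_sum] at h1
    simp only [map_smul, smul_eq_mul, LinearMap.smul_apply] at h1
    rw [h1, sub_self, Pi.zero_apply]
  -- A kernel vector read as a covector on the Bethe basis is a left θ_M-eigenvector of A, hence a
  -- multiple of g.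
  · let g' : Module.Dual ℂ V := e.constr ℂ Y
    have hg'e : ∀ k, g' (betheVec P A As v w ε y k) = Y k := fun k => by
      rw [← he]; exact e.constr_basis ℂ Y k
    have hg' : g' ∘ₗ A = P.θ M • g' := by
      refine e.ext fun j => ?_
      rw [LinearMap.comp_apply, LinearMap.smul_apply, he, hA.apply_betheVec hP hy, map_sum]
      simp only [map_smul, smul_eq_mul, hg'e]
      have := congrFun hY j
      rw [hmul, Pi.zero_apply, sub_eq_zero] at this
      exact this
    refine ⟨g' (v M) / g (v M), funext fun k => ?_⟩
    rw [← hg'e, hA.dual_eq_smul hg0 hg hg']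
    simp [hA.dual_apply_ne_zero hg0 hg]

end IsLeonardPair
end BetheLeonard

/-! ### Assembly of the theorem -/

open BetheLeonard

theorem mainTheorem5 (P : BetheLeonard.Params) (hP : P.Admissible)
    {V : Type*} [AddCommGroup V] [Module ℂ V] (A As : Module.End ℂ V)
    (v w : Module.Basis (Fin (P.d + 1)) ℂ V)
    (hA : BetheLeonard.IsLeonardPair P A As v w)
    (bra : Fin (P.d + 1) → Module.Dual ℂ V)
    (hbra_ne : ∀ M, bra M ≠ 0)
    (hbra : ∀ M, bra M ∘ₗ A = P.θ M • bra M) :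
    ∃ (ψ : ℤˣ → Fin (P.d + 1) → ℂ)
      (W : ℤˣ → Fin (P.d + 1) → (Fin (P.d + 1) → ℂ) →
        Matrix (Fin (P.d + 1)) (Fin (P.d + 1)) ℂ),
      ∀ (ε : ℤˣ) (M : Fin (P.d + 1)),
        ψ ε M ≠ 0 ∧
        (∀ y, BetheLeonard.Generic P y →
          (W ε M y).det ≠ 0 ∧
          (∀ k, (W ε M y * BetheLeonard.BSmat P ε M y) (Fin.last P.d) k = 0) ∧
          (∀ (m : ℤ) (α χ : ℂ), χ ≠ 0 → BetheLeonard.GaugeCondition P ε α χ m → ∀ k,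
            BetheLeonard.Xoff P A As v w bra ε α χ m M (BetheLeonard.drop y k) =
              ψ ε M * (-1) ^ ((k : ℕ) + 1) *
                BetheLeonard.lastRowMinor (W ε M y * BetheLeonard.BSmat P ε M y) k)) ∧
        (∀ y y', BetheLeonard.Generic P y → BetheLeonard.Generic P y' →
          ∀ k, (∀ i, i ≠ k → y i = y' i) →
            BetheLeonard.lastRowMinor (W ε M y * BetheLeonard.BSmat P ε M y) k =
              BetheLeonard.lastRowMinor (W ε M y' * BetheLeonard.BSmat P ε M y') k) := by
  classical
  let κ : ℤˣ → ℂ := fun ε => ∏ i : Fin P.d, P.cst ε ((P.d : ℤ) - 1 - (i : ℕ))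
  have hκ : ∀ ε, κ ε ≠ 0 := fun ε => Finset.prod_ne_zero_iff.2 fun i _ => hP.cst_ne_zero ε _
  have hbv : ∀ M, bra M (v M) ≠ 0 := fun M => hA.dual_apply_ne_zero (hbra_ne M) (hbra M)
  let X : ℤˣ → Fin (P.d + 1) → (Fin (P.d + 1) → ℂ) → Fin (P.d + 1) → ℂ := fun ε M y k =>
    κ ε / bra M (v M) * bra M (betheVec P A As v w ε y k)
  -- Any nonzero value serves for s > 0, as W absorbs it; for s = 0 the value is forced by the empty
  -- minor.
  let ψ : ℤˣ → Fin (P.d + 1) → ℂ := fun ε M =>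
    if P.d = 0 then -(κ ε / bra M (v M) * bra M (refState P v w ε)) else 1
  have hc : ∀ ε M, κ ε / bra M (v M) ≠ 0 := fun ε M => div_ne_zero (hκ ε) (hbv M)
  have hψ : ∀ ε M, ψ ε M ≠ 0 := by
    intro ε M
    simp only [ψ]
    split_ifs with hd
    · refine neg_ne_zero.2 (mul_ne_zero (hc ε M) fun h => hbra_ne M ?_)
      have hi : ∀ i : Fin (P.d + 1), i = 0 := fun i => Fin.ext (by rw [Fin.val_zero]; omega)
      unfold refState at h
      split_ifs at h
      · exact w.ext fun i => by rw [hi i, h, LinearMap.zero_apply]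
      · exact v.ext fun i => by rw [hi i, h, LinearMap.zero_apply]
    · exact one_ne_zero
  have hex : ∀ ε M y, ∃ W : Matrix (Fin (P.d + 1)) (Fin (P.d + 1)) ℂ, Generic P y →
      W.det ≠ 0 ∧ (∀ k, (W * BSmat P ε M y) (Fin.last P.d) k = 0) ∧
      ∀ k, X ε M y k = ψ ε M * (-1) ^ ((k : ℕ) + 1) * lastRowMinor (W * BSmat P ε M y) k := by
    intro ε M y
    by_cases hy : Generic P y
    · obtain ⟨h1, h2, h3⟩ := hA.kernel_BSmat hP hy ε (hbra_ne M) (hbra M)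
      have hXs : X ε M y = (κ ε / bra M (v M)) • fun k => bra M (betheVec P A As v w ε y k) := rfl
      obtain ⟨W, hW⟩ := exists_rowOperations (T := BSmat P ε M y) (X := X ε M y)
        (by rw [hXs]; exact smul_ne_zero (hc ε M) h1)
        (fun Y hY => by
          obtain ⟨a, ha⟩ := h3 Y hY
          refine ⟨a / (κ ε / bra M (v M)), ?_⟩
          rw [hXs, smul_smul, div_mul_cancel₀ _ (hc ε M), ha])
        (by rw [hXs, Matrix.mulVec_smul, h2, smul_zero]) (hψ ε M)
        (fun hd => by
          have hempty : IsEmpty (Fin P.d) := by rw [hd]; infer_instance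
          have hb : betheVec P A As v w ε y 0 = refState P v w ε := by
            simp [betheVec, Params.nodePoly]
          simp only [ψ, X, if_pos hd, hb])
      exact ⟨W, fun _ => hW⟩
    · exact ⟨1, fun h => absurd h hy⟩
  choose W hW using hex
  refine ⟨ψ, W, fun ε M => ⟨hψ ε M, fun y hy => ⟨(hW ε M y hy).1, (hW ε M y hy).2.1, ?_⟩, ?_⟩⟩
  · intro m α χ hχ hg k
    have hne : ∀ i, drop y k i ≠ 0 := fun i => hy.ne_zero _
    rw [← (hW ε M y hy).2.2 k, Xoff, betheState_eq hP ε hχ hg hne]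
    simp only [X, betheVec, κ, map_smul, smul_eq_mul]
    ring
  · intro y y' hy hy' k h
    -- X_k depends on y only through the family without y_k, so the minor does too, although W is
    -- chosen separately at each point.
    have hdrop : drop y k = drop y' k := funext fun i => h _ (Fin.succAbove_ne k i)
    have hX : X ε M y k = X ε M y' k := by simp only [X, betheVec, hdrop]
    rw [(hW ε M y hy).2.2 k, (hW ε M y' hy').2.2 k] at hX
    exact mul_left_cancel₀ (mul_ne_zero (hψ ε M) (by simp)) hX
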